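/- Let $m\ge 2$ and let $G=UT_m(\mathbb{Z})$ be the group of upper unitriangular integer $m\times m$ matrices. Let $s_{i,j}=1+e_{i,j}$ $(1\le i<j\le m)$, where $e_{i,j}$ is the matrix unit, and let $(a_1,\dots,a_n)$, $n=m(m-1)/2$, be the standard Mal'cev basis of $G$, consisting of the $s_{i,j}$ listed diagonal by diagonal: $s_{1,2},s_{2,3},\dots,s_{m-1,m},\,s_{1,3},s_{2,4},\dots,s_{m-2,m},\,\dots,\,s_{1,m}$. (This is a Mal'cev basis: every $g\in G$ is uniquely of the form $a_1^{x_1}\cdots a_n^{x_n}$ with $x_i\in\mathbb{Z}$, and the subgroups $\langle a_i,\dots,a_n\rangle$ form a strictly decreasing central series; and there are unique multiplication polynomials $q_i\in\mathbb{Z}[x_1,\dots,x_n,y_1,\dots,y_n]$ with $a_1^{x_1}\cdots a_n^{x_n}\cdot a_1^{y_1}\cdots a_n^{y_n}=a_1^{q_1}\cdots a_n^{q_n}$ for all integers $x_i,y_i$.) Let $t_i(a_1^{x_1}\cdots a_n^{x_n})=x_i$ be the coordinate functions, let $G$ act on $(\mathbb{Q}G)^*$, identified with the functions $G\to\mathbb{Q}$,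 by $f^g(h)=f(hg^{-1})$, and let $M$ be the $G$-submodule generated by $t_1,\dots,t_n$. Polynomials in $x_1,\dots,x_n$ over $\mathbb{Q}$ are regarded as elements of $(\mathbb{Q}G)^*$ through $a_1^{x_1}\cdots a_n^{x_n}\mapsto(x_1,\dots,x_n)$. Nickel's algorithm, for a fixed arbitrary linear order of the monomials, maintains a list $B$ of polynomials sorted by increasing leading monomial. $\mathrm{Insert}(B,f)$ goes through $B$ in decreasing order, each time subtracting from $f$ the multiple of the element of $B$ that removes the leading monomial of that element; it returns the resulting $r$, and puts $r$ at its place in $B$ if $r\neq0$. The algorithm starts with $B$ empty and inserts $t_1,\dots,t_n$; then, for $j=n,n-1,\dots,1$ and for each $f$ in a copy of the current $B$, it repeats "$f\gets f^{a_j}$ (computed by substituting $y_k=-\delta_{k,j}$ in the $q_i$); $r\gets\mathrm{Insert}(B,f)$" until $r=0$. It returns $B$. Then: 1. For every $N$ and every embedding of $G$ into $UT_N(\mathbb{Z})$ that is given by the matrices of the action of $G$ on $M$ in some $\mathbb{Q}$-basis of $M$, we have $N\ge 2^{\lfloor m/2\rfloor-1}$; in particular $N\ge 2^{m/2-2}$.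 2. For every order of the monomials, Nickel's algorithm terminates, and the list $B$ that it returns is a $\mathbb{Q}$-basis of $M$ with $N=|B|\ge 2^{\lfloor m/2\rfloor-1}\ge 2^{m/2-2}$ elements. The number of calls of $\mathrm{Insert}$ that it makes is also at least $2^{\lfloor m/2\rfloor-1}\ge 2^{m/2-2}$, so that the running time is exponential in $m$. 3. There is a polynomial in $M$ whose translates under the elements $w_S=\prod_{i\in S}s_{i,i+1}$ (factors in ascending order of $i$), for the $2^{\lfloor m/2\rfloor-1}$ subsets $S\subseteq\{2,\dots,\lfloor m/2\rfloor\}$, are linearly independent over $\mathbb{Q}$. -/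

import Mathlib

open scoped BigOperators

noncomputable section

namespace Nickel

/-! ### Unitriangular integer matrices -/

/-- `UT m` is the group of upper triangular integer `m × m` matrices with ones on the diagonal. -/
def UT (m : ℕ) : Subgroup (Matrix (Fin m) (Fin m) ℤ)ˣ where
  carrier := {A | (∀ i j, j < i → A.val i j = 0) ∧ ∀ i, A.val i i = 1}
  one_mem' := by
    refine ⟨fun i j h => ?_, fun i => ?_⟩
    · simp [h.ne']
    · simp
  mul_mem' := by
    rintro A B ⟨hA, hA1⟩ ⟨hB, hB1⟩
    refine ⟨fun i j h => ?_, fun i => ?_⟩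
    · rw [Units.val_mul, Matrix.mul_apply]
      refine Finset.sum_eq_zero fun k _ => ?_
      rcases lt_or_ge k i with hk | hk
      · rw [hA i k hk, zero_mul]
      · rw [hB k j (lt_of_lt_of_le h hk), mul_zero]
    · rw [Units.val_mul, Matrix.mul_apply, Finset.sum_eq_single i]
      · rw [hA1, hB1, one_mul]
      · intro k _ hk
        rcases lt_or_gt_of_ne hk with h | h
        · rw [hA i k h, zero_mul]
        · rw [hB k i h, mul_zero]
      · simp
  inv_mem' := by
    rintro A ⟨hA, hA1⟩
    have ht : (A⁻¹).val.BlockTriangular id := by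
      have hT : (A.val).BlockTriangular id := fun i j h => hA i j h
      let _ : Invertible A.val := A.invertible
      rw [Matrix.coe_units_inv]
      exact Matrix.blockTriangular_inv_of_blockTriangular hT
    refine ⟨fun i j h => ht h, fun i => ?_⟩
    have h1 : (A.val * (A⁻¹).val) i i = 1 := by
      rw [Units.mul_inv]; simp
    rw [Matrix.mul_apply, Finset.sum_eq_single i] at h1
    · rwa [hA1, one_mul] at h1
    · intro k _ hk
      rcases lt_or_gt_of_ne hk with h | h
      · rw [hA i k h, zero_mul]
      · rw [ht h, mul_zero]
    · simp

/-- Positions strictly above the diagonal of an `m × m` matrix. -/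
@[ext] structure UpperPair (m : ℕ) where
  /-- row -/
  row : Fin m
  /-- column -/
  col : Fin m
  lt : row < col

instance (m : ℕ) : Fintype (UpperPair m) :=
  Fintype.ofEquiv {p : Fin m × Fin m // p.1 < p.2}
    { toFun := fun p => ⟨p.1.1, p.1.2, p.2⟩
      invFun := fun p => ⟨(p.row, p.col), p.lt⟩
      left_inv := fun _ => rfl
      right_inv := fun _ => rfl }

/-- The standard ordering of the positions: diagonal by diagonal, starting next to the main
diagonal, and from top to bottom within each diagonal, that is
`(1,2), (2,3), …, (m-1,m), (1,3), (2,4), …, (1,m)`. -/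
instance (m : ℕ) : LinearOrder (UpperPair m) :=
  LinearOrder.lift'
    (fun p => toLex ((p.col : ℕ) - (p.row : ℕ), (p.row : ℕ)) : UpperPair m → ℕ ×ₗ ℕ) (by
    intro p p' h
    have h' := Prod.ext_iff.1 (toLex.injective h)
    have h1 : (p.col : ℕ) - p.row = p'.col - p'.row := h'.1
    have h2 : (p.row : ℕ) = p'.row := h'.2
    have h3 : (p.row : ℕ) < p.col := p.lt
    have h4 : (p'.row : ℕ) < p'.col := p'.lt
    apply UpperPair.ext <;> apply Fin.ext <;> omega)

/-- The elementary unitriangular matrix `s_{i,j} = 1 + e_{i,j}`. The family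
`(s p)` indexed by the ordered set `UpperPair m` is the standard Mal'cev basis of `UT m`. -/
def s {m : ℕ} (p : UpperPair m) : UT m :=
  ⟨{ val := Matrix.transvection p.row p.col 1
     inv := Matrix.transvection p.row p.col (-1)
     val_inv := by
      rw [Matrix.transvection_mul_transvection_same _ _ p.lt.ne]; simp
     inv_val := by
      rw [Matrix.transvection_mul_transvection_same _ _ p.lt.ne]; simp },
   by
    refine ⟨fun i j h => ?_, fun i => ?_⟩
    · have h1 : ¬ (p.row = i ∧ p.col = j) := by
        rintro ⟨rfl, rfl⟩; exact lt_asymm h p.lt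
      simp [Matrix.transvection, Matrix.single, h.ne', h1]
    · have h1 : ¬ (p.row = i ∧ p.col = i) := by
        rintro ⟨h2, h3⟩; exact p.lt.ne (h2.trans h3.symm)
      simp [Matrix.transvection, Matrix.single, h1]⟩

/-! ### Mal'cev bases, multiplication polynomials, the dual module -/

section General

variable {ι : Type} [Fintype ι] [LinearOrder ι] {G : Type} [Group G]

/-- The indices in increasing order. -/
def indices (ι : Type) [Fintype ι] [LinearOrder ι] : List ι :=
  (Finset.univ : Finset ι).sort (· ≤ ·)

/-- The ordered product `a_1^{x_1} ⋯ a_n^{x_n}`. -/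
def normalForm (a : ι → G) (x : ι → ℤ) : G :=
  ((indices ι).map fun i => a i ^ x i).prod

/-- `(a_i)` is a Mal'cev basis: every element is uniquely of the form `a_1^{x_1} ⋯ a_n^{x_n}`, and
the subgroups `G_i = ⟨a_i, …, a_n⟩` form a strictly decreasing central series ending in `1`
(the subgroup generated by the elements after `a_i` is `G_{i+1}`, or `1` for the last `i`). -/
structure IsMalcevBasis (a : ι → G) : Prop where
  bijective : Function.Bijective (normalForm a)
  normal : ∀ i, (Subgroup.closure (a '' Set.Ici i)).Normal
  strict : ∀ i, Subgroup.closure (a '' Set.Ioi i) < Subgroup.closure (a '' Set.Ici i)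
  central : ∀ i, ⁅Subgroup.closure (a '' Set.Ici i), (⊤ : Subgroup G)⁆ ≤
    Subgroup.closure (a '' Set.Ioi i)

/-- The exponents of `g` with respect to a Mal'cev basis: `coord a g i` is `x_i` when
`g = a_1^{x_1} ⋯ a_n^{x_n}`. -/
def coord (a : ι → G) (g : G) (i : ι) : ℤ := Function.invFun (normalForm a) g i

/-- `q_1, …, q_n ∈ ℤ[x_1, …, x_n, y_1, …, y_n]` (`Sum.inl` indexes the `x`, `Sum.inr` the `y`)
are the multiplication polynomials of `(a_i)`:
`a_1^{x_1} ⋯ a_n^{x_n} · a_1^{y_1} ⋯ a_n^{y_n} = a_1^{q_1(x,y)} ⋯ a_n^{q_n(x,y)}`. -/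
def IsMultiplicationPolynomials (a : ι → G) (q : ι → MvPolynomial (ι ⊕ ι) ℤ) : Prop :=
  ∀ x y : ι → ℤ, normalForm a x * normalForm a y =
    normalForm a fun i => MvPolynomial.eval (Sum.elim x y) (q i)

/-- The action of `g` on `(ℚG)^*`, that is `f^g(h) = f(h g⁻¹)`. A linear form on `ℚG` is
identified with its (arbitrary) function of values on the basis `G`. -/
def act (g : G) (f : G → ℚ) : G → ℚ := fun h => f (h * g⁻¹)

/-- A polynomial in `x_1, …, x_n` as an element of `(ℚG)^*`, where `a_1^{x_1} ⋯ a_n^{x_n}` is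
identified with `(x_1, …, x_n)`. -/
def polyFun (a : ι → G) (p : MvPolynomial ι ℚ) : G → ℚ :=
  fun g => MvPolynomial.eval (fun i => (coord a g i : ℚ)) p

/-- The `G`-submodule of `(ℚG)^*` generated by the coordinate functions `t_1, …, t_n`. -/
def coordModule (a : ι → G) : Submodule ℚ (G → ℚ) :=
  Submodule.span ℚ (Set.range fun gi : G × ι => act gi.1 fun h => (coord a h gi.2 : ℚ))

/-- `φ : G → UT_N(ℤ)` is an embedding given by the action of `G` on the module generated by the
coordinate functions, written as matrices in some basis `b_1, …, b_N` of that module: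
`b_i^g = ∑_j φ(g)_{i,j} b_j`. -/
def IsNickelEmbedding (a : ι → G) (N : ℕ) (φ : G →* UT N) : Prop :=
  Function.Injective φ ∧
  ∃ b : Fin N → G → ℚ, LinearIndependent ℚ b ∧
    Submodule.span ℚ (Set.range b) = coordModule a ∧
    ∀ g i, act g (b i) = ∑ j, (((φ g).val.val i j : ℤ) : ℚ) • b j

/-! ### Nickel's algorithm

A basis is a list of polynomials with increasing leading monomials, with respect to an arbitrary
fixed linear order `ord` of the monomials. -/

/-- The leading monomial (with a dummy value for the zero polynomial). -/
def leadMon (ord : LinearOrder (ι →₀ ℕ)) (p : MvPolynomial ι ℚ) : ι →₀ ℕ :=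
  (@Finset.max _ ord p.support).unbotD 0

/-- The reduction in `Insert`: go through the basis in decreasing order of leading monomials,
each time subtracting the multiple of the basis element that removes its leading monomial. -/
def reduce (ord : LinearOrder (ι →₀ ℕ)) (B : List (MvPolynomial ι ℚ)) (f : MvPolynomial ι ℚ) :
    MvPolynomial ι ℚ :=
  B.foldr (fun b r => r - (r.coeff (leadMon ord b) / b.coeff (leadMon ord b)) • b) f

open Classical in
/-- `Insert(B, f)`: the basis after the call. The value returned by the call is
`reduce ord B f`, which is put at its place in the basis unless it is zero. -/
def insertPoly (ord : LinearOrder (ι →₀ ℕ)) (B : List (MvPolynomial ι ℚ)) (f : MvPolynomial ι ℚ) :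
    List (MvPolynomial ι ℚ) :=
  if reduce ord B f = 0 then B
  else List.orderedInsert (fun p p' => ord.le (leadMon ord p) (leadMon ord p')) (reduce ord B f) B

/-- `f^{a_j} = f(q_1^{(j)}, …, q_n^{(j)})`, where `q_i^{(j)}` is obtained from `q_i` by the
substitution `y_k = -δ_{k,j}`. -/
def subst (q : ι → MvPolynomial (ι ⊕ ι) ℤ) (j : ι) (f : MvPolynomial ι ℚ) : MvPolynomial ι ℚ :=
  MvPolynomial.aeval (fun i => MvPolynomial.aeval
    (Sum.elim MvPolynomial.X fun k => if k = j then (-1 : MvPolynomial ι ℚ) else 0) (q i)) f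

/-- `RepeatLoop ord q j B f B' c`: the loop
`repeat f^{a_j} ← f(q^{(j)}); r ← Insert(B, f^{a_j}); f ← f^{a_j} until r = 0`,
started with basis `B` and polynomial `f`, stops with basis `B'` after `c` calls of `Insert`. -/
inductive RepeatLoop (ord : LinearOrder (ι →₀ ℕ)) (q : ι → MvPolynomial (ι ⊕ ι) ℤ) (j : ι) :
    List (MvPolynomial ι ℚ) → MvPolynomial ι ℚ → List (MvPolynomial ι ℚ) → ℕ → Prop
  | finish {B f} (h : reduce ord B (subst q j f) = 0) : RepeatLoop ord q j B f B 1
  | again {B f B' c} (h : reduce ord B (subst q j f) ≠ 0)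
      (h' : RepeatLoop ord q j (insertPoly ord B (subst q j f)) (subst q j f) B' c) :
      RepeatLoop ord q j B f B' (c + 1)

/-- `ForEachLoop ord q j L B B' c`: running the repeat-loop for each `f` in the list `L` in turn
changes the basis from `B` to `B'` with `c` calls of `Insert`. -/
inductive ForEachLoop (ord : LinearOrder (ι →₀ ℕ)) (q : ι → MvPolynomial (ι ⊕ ι) ℤ) (j : ι) :
    List (MvPolynomial ι ℚ) → List (MvPolynomial ι ℚ) → List (MvPolynomial ι ℚ) → ℕ → Prop
  | nil {B} : ForEachLoop ord q j [] B B 0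
  | cons {f L B B' B'' c d} (h : RepeatLoop ord q j B f B' c)
      (h' : ForEachLoop ord q j L B' B'' d) : ForEachLoop ord q j (f :: L) B B'' (c + d)

/-- `ForLoop ord q J B B' c`: for each index `j` in the list `J` in turn, run the for-each-loop
over a copy of the current basis. -/
inductive ForLoop (ord : LinearOrder (ι →₀ ℕ)) (q : ι → MvPolynomial (ι ⊕ ι) ℤ) :
    List ι → List (MvPolynomial ι ℚ) → List (MvPolynomial ι ℚ) → ℕ → Prop
  | nil {B} : ForLoop ord q [] B B 0
  | cons {j J B B' B'' c d} (h : ForEachLoop ord q j B B B' c)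
      (h' : ForLoop ord q J B' B'' d) : ForLoop ord q (j :: J) B B'' (c + d)

/-- `Run ord q B c`: Nickel's algorithm, on input of the multiplication polynomials `q` and of the
coordinate functions `t_1, …, t_n` as initial polynomials, terminates and returns the basis `B`,
having made `c` calls of `Insert`. The main loop runs over `j = n, …, 1`. -/
def Run (ord : LinearOrder (ι →₀ ℕ)) (q : ι → MvPolynomial (ι ⊕ ι) ℤ)
    (B : List (MvPolynomial ι ℚ)) (c : ℕ) : Prop :=
  ∃ d, ForLoop ord q (indices ι).reverse
      (((indices ι).map MvPolynomial.X).foldl (insertPoly ord) []) B d ∧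
    c = (indices ι).length + d

end General

/-! ### The elements `w_S` -/

/-- The position `(i, i+1)`, where `i : Fin (m-1)` is counted from `0`. -/
def superdiagonal {m : ℕ} (i : Fin (m - 1)) : UpperPair m where
  row := ⟨i, by omega⟩
  col := ⟨i + 1, by omega⟩
  lt := by simp [Fin.lt_def]

/-- `w_S = ∏_{i ∈ S} s_{i,i+1}`, the factors being in ascending order. -/
def w {m : ℕ} (S : Finset (Fin (m - 1))) : UT m :=
  ((S.sort (· ≤ ·)).map fun i => s (superdiagonal i)).prod

end Nickel

end

namespace Nickel

/-! ### Lists of polynomials with increasing leading monomials -/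

section Reduction

variable {ι : Type} {ord : LinearOrder (ι →₀ ℕ)}

/-! Everything rests on a lower bound for the dimension of the module `M` of coordinate functions.
Indices here are one-based, as in the theorem.

For `g` in `UT m`, let `E(g)` be the ordered product of the factors of the normal form that lie next
to the diagonal (`superdiagonalPart`). Its entry at `(i, m)` is the product of the superdiagonal
entries of `g` in rows `i, …, m-1`. Diagonals are listed in order, so `E(g)` is an initial segment
of the normal form. When the lower half of the last column of `g` agrees with that of `E(g)`,
commuting factors can be exchanged to give `t_{j,m}(g) = -(g⁻¹ E(g))_{j,m}` for `j < m-1`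
(`coord_eq_of_superdiagonalPart`). Hence `f₀ = t_{1,m}^{s_{1,2}} - t_{1,m} - t_{2,m}`, an element of
`M`, takes the value `E(h)_{2,m}` at every such `h` whose first row is a unit vector
(`coord_sub_sub_eq`).

Let `c` be the product of the `s_{i,i+1}` with `i > ⌊m/2⌋`, and `f = f₀^{c⁻¹}`. The value of
`f^{w_S}` at `w_T` is `f₀(w_T w_S⁻¹ c)`. Superdiagonal entries add under multiplication, so this is
the product of the numbers `[i ∈ T] - [i ∈ S]` over `2 ≤ i ≤ ⌊m/2⌋`, the other rows contributing
ones. It is nonzero exactly when `T` is the complement of `S` (`exists_separating`). So the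
translates `f^{w_S}` are independent, and `M` has dimension at least `2^(⌊m/2⌋-1)`.

For the algorithm, the span of the list stays inside `M`, which is finite-dimensional because
coordinates are polynomials in matrix entries; this gives termination. After the pass for `a_j` the
span is invariant under `a_j`, and every group element is a product `a_n^{z_n} ⋯ a_1^{z_1}`, so the
final span contains all translates of the coordinates (`Run.span_eq`). Each call of `Insert` adds at
most one element, so the number of calls is at least the length of the output. -/

theorem leadMon_mem_support {p : MvPolynomial ι ℚ} (hp : p ≠ 0) : leadMon ord p ∈ p.support := by
  obtain ⟨μ, hμ⟩ := @Finset.max_of_nonempty _ ord p.support (MvPolynomial.support_nonempty.2 hp)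
  have h := @Finset.mem_of_max _ ord p.support _ hμ
  rw [leadMon, hμ]
  exact h

theorem coeff_leadMon_ne_zero {p : MvPolynomial ι ℚ} (hp : p ≠ 0) :
    p.coeff (leadMon ord p) ≠ 0 :=
  MvPolynomial.mem_support_iff.1 (leadMon_mem_support hp)

theorem le_leadMon {p : MvPolynomial ι ℚ} {μ : ι →₀ ℕ} (hμ : p.coeff μ ≠ 0) :
    ord.le μ (leadMon ord p) := by
  have hp : p ≠ 0 := by rintro rfl; simp at hμ
  obtain ⟨ν, hν⟩ := @Finset.max_of_nonempty _ ord p.support (MvPolynomial.support_nonempty.2 hp)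
  have h := @Finset.le_max _ ord μ p.support (MvPolynomial.mem_support_iff.2 hμ)
  rw [hν] at h
  rw [leadMon, hν]
  exact (@WithBot.coe_le_coe _ μ ν ord.toLE).1 h

theorem coeff_eq_zero_of_leadMon_lt {p : MvPolynomial ι ℚ} {μ : ι →₀ ℕ}
    (hμ : ord.lt (leadMon ord p) μ) : p.coeff μ = 0 := by
  by_contra h
  exact (@not_lt_of_ge _ ord.toPreorder _ _ (le_leadMon h)) hμ

/-- The list consists of nonzero polynomials with strictly increasing leading monomials. -/
structure IsReduced (ord : LinearOrder (ι →₀ ℕ)) (B : List (MvPolynomial ι ℚ)) : Prop where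
  ne_zero : ∀ b ∈ B, b ≠ 0
  pairwise : B.Pairwise fun b b' => ord.lt (leadMon ord b) (leadMon ord b')

/-- The span of the elements of a list of polynomials. -/
noncomputable def listSpan (B : List (MvPolynomial ι ℚ)) : Submodule ℚ (MvPolynomial ι ℚ) :=
  Submodule.span ℚ {b | b ∈ B}

theorem mem_listSpan {B : List (MvPolynomial ι ℚ)} {b : MvPolynomial ι ℚ} (hb : b ∈ B) :
    b ∈ listSpan B := Submodule.subset_span hb

theorem listSpan_le {B : List (MvPolynomial ι ℚ)} {W : Submodule ℚ (MvPolynomial ι ℚ)} :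
    listSpan B ≤ W ↔ ∀ b ∈ B, b ∈ W := Submodule.span_le

theorem listSpan_cons (b : MvPolynomial ι ℚ) (B : List (MvPolynomial ι ℚ)) :
    listSpan (b :: B) = Submodule.span ℚ {b} ⊔ listSpan B := by
  rw [listSpan, listSpan, ← Submodule.span_union]
  congr 1
  ext x
  simp

theorem reduce_sub_mem (B : List (MvPolynomial ι ℚ)) (f : MvPolynomial ι ℚ) :
    f - reduce ord B f ∈ listSpan B := by
  induction B with
  | nil => simp [reduce]
  | cons b B ih =>
    have h1 : reduce ord (b :: B) f = reduce ord B f -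
        ((reduce ord B f).coeff (leadMon ord b) / b.coeff (leadMon ord b)) • b := rfl
    rw [h1, listSpan_cons, sub_sub_eq_add_sub, add_sub_right_comm]
    exact Submodule.add_mem _ (Submodule.mem_sup_right ih)
      (Submodule.mem_sup_left (Submodule.smul_mem _ _ (Submodule.mem_span_singleton_self b)))

theorem mem_listSpan_of_reduce_eq_zero {B : List (MvPolynomial ι ℚ)} {f : MvPolynomial ι ℚ}
    (h : reduce ord B f = 0) : f ∈ listSpan B := by
  simpa [h] using reduce_sub_mem (ord := ord) B f

theorem IsReduced.tail {b : MvPolynomial ι ℚ} {B : List (MvPolynomial ι ℚ)}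
    (h : IsReduced ord (b :: B)) : IsReduced ord B :=
  ⟨fun c hc => h.ne_zero c (List.mem_cons_of_mem _ hc), (List.pairwise_cons.1 h.pairwise).2⟩

/-- The head of the list is subtracted last. It has no coefficient at the larger leading monomials
of the tail, so zeros produced earlier survive. -/
theorem IsReduced.coeff_reduce {B : List (MvPolynomial ι ℚ)} (hB : IsReduced ord B)
    (f : MvPolynomial ι ℚ) : ∀ b ∈ B, (reduce ord B f).coeff (leadMon ord b) = 0 := by
  induction B with
  | nil => simp
  | cons b B ih =>
    have h1 : reduce ord (b :: B) f = reduce ord B f -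
        ((reduce ord B f).coeff (leadMon ord b) / b.coeff (leadMon ord b)) • b := rfl
    intro c hc
    rw [h1, MvPolynomial.coeff_sub, MvPolynomial.coeff_smul, smul_eq_mul]
    rcases List.mem_cons.1 hc with rfl | hc
    · rw [div_mul_cancel₀ _ (coeff_leadMon_ne_zero (hB.ne_zero c List.mem_cons_self)), sub_self]
    · rw [ih hB.tail c hc,
        coeff_eq_zero_of_leadMon_lt ((List.pairwise_cons.1 hB.pairwise).1 c hc)]
      simp

/-- The keys must differ from that of the new element to keep the order strict. A nonzero reduced
polynomial satisfies this, since its coefficients at all leading monomials of the list vanish. -/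
theorem pairwise_orderedInsert {α β : Type} {lo : LinearOrder β} [DecidableRel lo.le] (k : α → β)
    (r : α → α → Prop) [DecidableRel r] (hr : ∀ x y, r x y ↔ lo.le (k x) (k y))
    (a : α) (l : List α) (hl : l.Pairwise fun b b' => lo.lt (k b) (k b'))
    (ha : ∀ b ∈ l, k b ≠ k a) :
    (List.orderedInsert r a l).Pairwise fun b b' => lo.lt (k b) (k b') := by
  induction l with
  | nil => simp
  | cons b l ih =>
    obtain ⟨h1, h2⟩ := List.pairwise_cons.1 hl
    rw [List.orderedInsert_cons]
    split_ifs with h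
    · rw [hr] at h
      have h3 : lo.lt (k a) (k b) :=
        @lt_of_le_of_ne _ lo.toPartialOrder _ _ h (ha b List.mem_cons_self).symm
      refine List.pairwise_cons.2 ⟨fun c hc => ?_, hl⟩
      rcases List.mem_cons.1 hc with rfl | hc
      · exact h3
      · exact @lt_trans _ lo.toPreorder _ _ _ h3 (h1 c hc)
    · rw [hr] at h
      refine List.pairwise_cons.2
        ⟨fun c hc => ?_, ih h2 fun c hc => ha c (List.mem_cons_of_mem _ hc)⟩
      rcases (List.mem_orderedInsert r).1 hc with rfl | hc
      · exact (@not_le _ lo _ _).1 h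
      · exact h1 c hc

theorem IsReduced.linearIndependent {B : List (MvPolynomial ι ℚ)} (hB : IsReduced ord B) :
    LinearIndependent ℚ fun k : Fin B.length => B.get k := by
  rw [Fintype.linearIndependent_iff]
  intro c hc
  by_contra! hne
  -- At the leading monomial of the last element with nonzero coefficient, no other term of the
  -- relation contributes.
  obtain ⟨i, hi, hmax⟩ := (Finset.univ.filter fun i => c i ≠ 0).exists_maximal
    ((Finset.filter_nonempty_iff).2 (by simpa using hne))
  have hi' : c i ≠ 0 := by simpa using hi
  have h := congrArg (MvPolynomial.coeff (leadMon ord (B.get i))) hc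
  rw [MvPolynomial.coeff_sum, Finset.sum_eq_single i, MvPolynomial.coeff_smul, smul_eq_mul,
    MvPolynomial.coeff_zero] at h
  · exact mul_ne_zero hi' (coeff_leadMon_ne_zero (hB.ne_zero _ (List.get_mem _ _))) h
  · intro j _ hj
    rw [MvPolynomial.coeff_smul, smul_eq_mul]
    rcases lt_or_gt_of_ne hj with hlt | hgt
    · rw [coeff_eq_zero_of_leadMon_lt (List.pairwise_iff_get.1 hB.pairwise j i hlt), mul_zero]
    · have : c j = 0 := by
        by_contra hcj
        have := hmax (by simpa using hcj) hgt.le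
        exact absurd this (not_le_of_gt hgt)
      rw [this, zero_mul]
  · simp

theorem IsReduced.length_eq_finrank {B : List (MvPolynomial ι ℚ)} (hB : IsReduced ord B) :
    B.length = Module.finrank ℚ (listSpan B) := by
  have h := finrank_span_eq_card hB.linearIndependent
  rw [Fintype.card_fin] at h
  rw [← h, listSpan]
  have h1 : Set.range (fun k : Fin B.length => B.get k) = {b | b ∈ B} := by
    ext x
    exact List.mem_iff_get.symm
  rw [h1]

theorem IsReduced.length_le_finrank {B : List (MvPolynomial ι ℚ)} (hB : IsReduced ord B)
    {W : Submodule ℚ (MvPolynomial ι ℚ)}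
    [FiniteDimensional ℚ W] (hBW : listSpan B ≤ W) : B.length ≤ Module.finrank ℚ W := by
  rw [hB.length_eq_finrank]
  exact Submodule.finrank_mono hBW

variable [LinearOrder ι]

theorem insertPoly_of_eq_zero {B : List (MvPolynomial ι ℚ)} {f : MvPolynomial ι ℚ}
    (h : reduce ord B f = 0) : insertPoly ord B f = B := by
  rw [insertPoly, if_pos h]

theorem perm_insertPoly {B : List (MvPolynomial ι ℚ)} {f : MvPolynomial ι ℚ}
    (h : reduce ord B f ≠ 0) : (insertPoly ord B f).Perm (reduce ord B f :: B) := by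
  rw [insertPoly, if_neg h]
  exact List.perm_orderedInsert _ _ _

theorem length_insertPoly_le (B : List (MvPolynomial ι ℚ)) (f : MvPolynomial ι ℚ) :
    (insertPoly ord B f).length ≤ B.length + 1 := by
  by_cases h : reduce ord B f = 0
  · rw [insertPoly_of_eq_zero h]; omega
  · rw [(perm_insertPoly h).length_eq, List.length_cons]

theorem listSpan_insertPoly (B : List (MvPolynomial ι ℚ)) (f : MvPolynomial ι ℚ) :
    listSpan (insertPoly ord B f) = listSpan B ⊔ Submodule.span ℚ {f} := by
  have hf := reduce_sub_mem (ord := ord) B f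
  by_cases h : reduce ord B f = 0
  · rw [insertPoly_of_eq_zero h, eq_comm, sup_eq_left, Submodule.span_singleton_le_iff_mem]
    simpa [h] using hf
  · have h1 : listSpan (insertPoly ord B f) = listSpan (reduce ord B f :: B) := by
      rw [listSpan, listSpan]
      congr 1
      ext x
      exact (perm_insertPoly h).mem_iff
    rw [h1, listSpan_cons, sup_comm]
    apply le_antisymm <;> refine sup_le le_sup_left ?_ <;>
      rw [Submodule.span_singleton_le_iff_mem]
    · rw [← sub_sub_cancel f (reduce ord B f)]
      exact Submodule.sub_mem _ (Submodule.mem_sup_right (Submodule.mem_span_singleton_self f))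
        (Submodule.mem_sup_left hf)
    · have h2 := Submodule.add_mem (Submodule.span ℚ {reduce ord B f} ⊔ listSpan B)
        (Submodule.mem_sup_right hf)
        (Submodule.mem_sup_left (Submodule.mem_span_singleton_self (reduce ord B f)))
      rwa [sub_add_cancel, sup_comm] at h2

theorem IsReduced.insertPoly {B : List (MvPolynomial ι ℚ)} (hB : IsReduced ord B)
    (f : MvPolynomial ι ℚ) : IsReduced ord (insertPoly ord B f) := by
  by_cases h : reduce ord B f = 0
  · rwa [insertPoly_of_eq_zero h]
  · refine ⟨fun b hb => ?_, ?_⟩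
    · rcases List.mem_cons.1 ((perm_insertPoly h).mem_iff.1 hb) with rfl | hb
      · exact h
      · exact hB.ne_zero b hb
    · classical
      rw [Nickel.insertPoly, if_neg h]
      refine pairwise_orderedInsert (lo := ord) (leadMon ord) _ (fun _ _ => Iff.rfl) _ _
        hB.pairwise fun b hb h1 => coeff_leadMon_ne_zero (ord := ord) h ?_
      rw [← h1]
      exact hB.coeff_reduce f b hb

end Reduction

/-! ### The loops of Nickel's algorithm -/

section Loops

variable {ι : Type} {ord : LinearOrder (ι →₀ ℕ)}

/-- The properties of a loop that are preserved by composition: the basis stays reduced, the number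
of new elements is bounded by the number `c` of calls of `Insert`, and the span grows. -/
structure Extends (ord : LinearOrder (ι →₀ ℕ)) (B B' : List (MvPolynomial ι ℚ)) (c : ℕ) :
    Prop where
  isReduced : IsReduced ord B → IsReduced ord B'
  length_le : B'.length ≤ B.length + c
  span_le : listSpan B ≤ listSpan B'

theorem Extends.refl (B : List (MvPolynomial ι ℚ)) (c : ℕ) : Extends ord B B c :=
  ⟨id, Nat.le_add_right _ _, le_rfl⟩

theorem Extends.trans {B B' B'' : List (MvPolynomial ι ℚ)} {c d : ℕ} (h : Extends ord B B' c)
    (h' : Extends ord B' B'' d) : Extends ord B B'' (c + d) :=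
  ⟨fun hB => h'.isReduced (h.isReduced hB), by have := h.length_le; have := h'.length_le; omega,
    h.span_le.trans h'.span_le⟩

variable [LinearOrder ι] {q : ι → MvPolynomial (ι ⊕ ι) ℤ}

/-- Substitution of the polynomials `q_i^{(j)}`, as a linear map. -/
noncomputable def substLin (q : ι → MvPolynomial (ι ⊕ ι) ℤ) (j : ι) :
    MvPolynomial ι ℚ →ₗ[ℚ] MvPolynomial ι ℚ :=
  (MvPolynomial.aeval (fun i => MvPolynomial.aeval
    (Sum.elim MvPolynomial.X fun k => if k = j then (-1 : MvPolynomial ι ℚ) else 0)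
    (q i))).toLinearMap

theorem substLin_apply (j : ι) (f : MvPolynomial ι ℚ) : substLin q j f = subst q j f := rfl

theorem mem_comap_substLin {W : Submodule ℚ (MvPolynomial ι ℚ)} {j : ι} {f : MvPolynomial ι ℚ} :
    f ∈ W.comap (substLin q j) ↔ subst q j f ∈ W := by
  rw [Submodule.mem_comap, substLin_apply]

theorem listSpan_insertPoly_le {B : List (MvPolynomial ι ℚ)} {f : MvPolynomial ι ℚ}
    {W : Submodule ℚ (MvPolynomial ι ℚ)} (hB : listSpan B ≤ W) (hf : f ∈ W) :
    listSpan (insertPoly ord B f) ≤ W := by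
  rw [listSpan_insertPoly]
  exact sup_le hB ((Submodule.span_singleton_le_iff_mem _ _).2 hf)

theorem extends_insertPoly (B : List (MvPolynomial ι ℚ)) (f : MvPolynomial ι ℚ) :
    Extends ord B (insertPoly ord B f) 1 :=
  ⟨fun hB => hB.insertPoly f, length_insertPoly_le B f, by
    rw [listSpan_insertPoly]; exact le_sup_left⟩

theorem RepeatLoop.extends {j : ι} {B B' : List (MvPolynomial ι ℚ)} {f : MvPolynomial ι ℚ} {c : ℕ}
    (h : RepeatLoop ord q j B f B' c) : Extends ord B B' c := by
  induction h with
  | finish h => exact Extends.refl _ _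
  | again h h' ih => rw [add_comm]; exact (extends_insertPoly _ _).trans ih

theorem RepeatLoop.span_le {j : ι} {B B' : List (MvPolynomial ι ℚ)} {f : MvPolynomial ι ℚ} {c : ℕ}
    (h : RepeatLoop ord q j B f B' c) {W : Submodule ℚ (MvPolynomial ι ℚ)}
    (hW : W ≤ W.comap (substLin q j)) (hB : listSpan B ≤ W) (hf : f ∈ W) : listSpan B' ≤ W := by
  induction h with
  | finish h => exact hB
  | again h h' ih =>
    have h1 := mem_comap_substLin.1 (hW hf)
    exact ih (listSpan_insertPoly_le hB h1) h1

/-- The whole span need not be invariant yet, because other elements of `B` may be unprocessed. `Q`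
isolates the part spanned by the newly inserted images of `f`: each is mapped to the next one, and
the last into the span because its image reduces to zero. -/
theorem RepeatLoop.exists_submodule {j : ι} {B B' : List (MvPolynomial ι ℚ)}
    {f : MvPolynomial ι ℚ} {c : ℕ} (h : RepeatLoop ord q j B f B' c) :
    ∃ Q, listSpan B' = listSpan B ⊔ Q ∧ subst q j f ∈ listSpan B' ∧
      Q ≤ (listSpan B').comap (substLin q j) := by
  induction h with
  | finish h => exact ⟨⊥, by simp, mem_listSpan_of_reduce_eq_zero h, bot_le⟩
  | @again B f B' c h h' ih =>
    obtain ⟨Q, h1, h2, h3⟩ := ih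
    rw [listSpan_insertPoly, sup_assoc] at h1
    refine ⟨_, h1, ?_, sup_le ?_ h3⟩
    · rw [h1]
      exact Submodule.mem_sup_right
        (Submodule.mem_sup_left (Submodule.mem_span_singleton_self _))
    · rw [Submodule.span_singleton_le_iff_mem, mem_comap_substLin]
      exact h2

theorem ForEachLoop.extends {j : ι} {L B B' : List (MvPolynomial ι ℚ)} {c : ℕ}
    (h : ForEachLoop ord q j L B B' c) : Extends ord B B' c := by
  induction h with
  | nil => exact Extends.refl _ _
  | cons h h' ih => exact h.extends.trans ih

theorem ForEachLoop.span_le {j : ι} {L B B' : List (MvPolynomial ι ℚ)} {c : ℕ}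
    (h : ForEachLoop ord q j L B B' c) {W : Submodule ℚ (MvPolynomial ι ℚ)}
    (hW : W ≤ W.comap (substLin q j)) (hB : listSpan B ≤ W) (hL : ∀ f ∈ L, f ∈ W) :
    listSpan B' ≤ W := by
  induction h with
  | nil => exact hB
  | cons h h' ih =>
    exact ih (h.span_le hW hB (hL _ List.mem_cons_self)) fun f hf =>
      hL f (List.mem_cons_of_mem _ hf)

theorem ForEachLoop.exists_submodule {j : ι} {L B B' : List (MvPolynomial ι ℚ)} {c : ℕ}
    (h : ForEachLoop ord q j L B B' c) :
    ∃ Q, listSpan B' = listSpan B ⊔ Q ∧ (∀ f ∈ L, subst q j f ∈ listSpan B') ∧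
      Q ≤ (listSpan B').comap (substLin q j) := by
  induction h with
  | nil => exact ⟨⊥, by simp, by simp, bot_le⟩
  | @cons f L B B' B'' c d h h' ih =>
    obtain ⟨Q, h1, h2, h3⟩ := h.exists_submodule
    obtain ⟨Q', h1', h2', h3'⟩ := ih
    have hle : listSpan B' ≤ listSpan B'' := h'.extends.span_le
    refine ⟨Q ⊔ Q', by rw [h1', h1, sup_assoc], ?_,
      sup_le (h3.trans (Submodule.comap_mono hle)) h3'⟩
    intro g hg
    rcases List.mem_cons.1 hg with rfl | hg
    · exact hle h2
    · exact h2' g hg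

/-- After the for-each-loop over a copy of the basis, the span of the basis is invariant. -/
theorem ForEachLoop.invariant {j : ι} {B B' : List (MvPolynomial ι ℚ)} {c : ℕ}
    (h : ForEachLoop ord q j B B B' c) :
    listSpan B' ≤ (listSpan B').comap (substLin q j) := by
  obtain ⟨Q, h1, h2, h3⟩ := h.exists_submodule
  nth_rewrite 1 [h1]
  exact sup_le (listSpan_le.2 fun f hf => mem_comap_substLin.2 (h2 f hf)) h3

theorem ForLoop.extends {J : List ι} {B B' : List (MvPolynomial ι ℚ)} {c : ℕ}
    (h : ForLoop ord q J B B' c) : Extends ord B B' c := by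
  induction h with
  | nil => exact Extends.refl _ _
  | cons h h' ih => exact h.extends.trans ih

theorem ForLoop.span_le {J : List ι} {B B' : List (MvPolynomial ι ℚ)} {c : ℕ}
    (h : ForLoop ord q J B B' c) {W : Submodule ℚ (MvPolynomial ι ℚ)}
    (hW : ∀ j, W ≤ W.comap (substLin q j)) (hB : listSpan B ≤ W) :
    listSpan B' ≤ W := by
  induction h with
  | nil => exact hB
  | cons h h' ih => exact ih (h.span_le (hW _) hB (listSpan_le.1 hB))

/-! ### The initial basis -/

theorem foldl_insertPoly (L B : List (MvPolynomial ι ℚ)) :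
    Extends ord B (L.foldl (insertPoly ord) B) L.length ∧
      listSpan (L.foldl (insertPoly ord) B) = listSpan B ⊔ listSpan L := by
  induction L generalizing B with
  | nil => exact ⟨Extends.refl _ _, by simp [listSpan]⟩
  | cons f L ih =>
    obtain ⟨h1, h2⟩ := ih (insertPoly ord B f)
    refine ⟨?_, ?_⟩
    · rw [List.length_cons, add_comm]
      exact (extends_insertPoly B f).trans h1
    · rw [List.foldl_cons, h2, listSpan_insertPoly, listSpan_cons, sup_assoc]

/-! ### Termination -/

variable {W : Submodule ℚ (MvPolynomial ι ℚ)} [FiniteDimensional ℚ W]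

/-- Each unsuccessful test lengthens an independent list inside `W`, so `finrank W - B.length`
decreases. -/
theorem exists_repeatLoop {j : ι} (hW : W ≤ W.comap (substLin q j)) (n : ℕ)
    (B : List (MvPolynomial ι ℚ)) (f : MvPolynomial ι ℚ) (hB : IsReduced ord B)
    (hBW : listSpan B ≤ W) (hf : f ∈ W) (hn : Module.finrank ℚ W - B.length = n) :
    ∃ B' c, RepeatLoop ord q j B f B' c := by
  induction n using Nat.strong_induction_on generalizing B f with
  | _ n ih =>
    by_cases h : reduce ord B (subst q j f) = 0
    · exact ⟨_, _, RepeatLoop.finish h⟩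
    · have hf' : subst q j f ∈ W := mem_comap_substLin.1 (hW hf)
      have h1 := hB.insertPoly (subst q j f)
      have h2 := listSpan_insertPoly_le (ord := ord) hBW hf'
      have h3 := h1.length_le_finrank h2
      have h4 := (perm_insertPoly h).length_eq
      rw [List.length_cons] at h4
      obtain ⟨B', c, h5⟩ := ih _ (by omega) _ _ h1 h2 hf' rfl
      exact ⟨_, _, RepeatLoop.again h h5⟩

theorem exists_forEachLoop {j : ι} (hW : W ≤ W.comap (substLin q j))
    (L B : List (MvPolynomial ι ℚ)) (hB : IsReduced ord B) (hBW : listSpan B ≤ W)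
    (hL : ∀ f ∈ L, f ∈ W) : ∃ B' c, ForEachLoop ord q j L B B' c := by
  induction L generalizing B with
  | nil => exact ⟨_, _, ForEachLoop.nil⟩
  | cons f L ih =>
    have hf := hL f List.mem_cons_self
    obtain ⟨B', c, h⟩ := exists_repeatLoop hW _ B f hB hBW hf rfl
    obtain ⟨B'', d, h'⟩ := ih B' (h.extends.isReduced hB) (h.span_le hW hBW hf)
      fun g hg => hL g (List.mem_cons_of_mem _ hg)
    exact ⟨_, _, ForEachLoop.cons h h'⟩

theorem exists_forLoop (hW : ∀ j, W ≤ W.comap (substLin q j)) (J : List ι)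
    (B : List (MvPolynomial ι ℚ)) (hB : IsReduced ord B) (hBW : listSpan B ≤ W) :
    ∃ B' c, ForLoop ord q J B B' c := by
  induction J generalizing B with
  | nil => exact ⟨_, _, ForLoop.nil⟩
  | cons j J ih =>
    have hL := listSpan_le.1 hBW
    obtain ⟨B', c, h⟩ := exists_forEachLoop (hW j) B B hB hBW hL
    obtain ⟨B'', d, h'⟩ := ih B' (h.extends.isReduced hB) (h.span_le (hW j) hBW hL)
    exact ⟨_, _, ForLoop.cons h h'⟩

end Loops

/-! ### Polynomials as functions on the group -/

section Functions

theorem prod_map_pow_single {ι G : Type} [DecidableEq ι] [Group G] (a : ι → G) (l : List ι)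
    (hl : l.Nodup) (j : ι) (hj : j ∈ l) (z : ℤ) :
    (l.map fun i => a i ^ (if i = j then z else 0)).prod = a j ^ z := by
  induction l with
  | nil => simp at hj
  | cons i l ih =>
    obtain ⟨h1, h2⟩ := List.nodup_cons.1 hl
    rw [List.map_cons, List.prod_cons]
    by_cases hij : i = j
    · subst hij
      rw [if_pos rfl, List.prod_eq_one, mul_one]
      simp only [List.mem_map]
      rintro _ ⟨k, hk, rfl⟩
      rw [if_neg (by rintro rfl; exact h1 hk), zpow_zero]
    · rw [if_neg hij, zpow_zero, one_mul]
      exact ih h2 ((List.mem_cons.1 hj).resolve_left (Ne.symm hij))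

variable {ι : Type} [Fintype ι] [LinearOrder ι] {G : Type} [Group G] {a : ι → G}
  {q : ι → MvPolynomial (ι ⊕ ι) ℤ}

theorem mem_indices (i : ι) : i ∈ indices ι := by simp [indices]

theorem pairwise_indices : (indices ι).Pairwise (· < ·) :=
  Finset.sortedLT_sort _ |>.pairwise

theorem coord_normalForm (ha : Function.Bijective (normalForm a)) (x : ι → ℤ) :
    coord a (normalForm a x) = x :=
  Function.leftInverse_invFun ha.injective x

theorem normalForm_coord (ha : Function.Bijective (normalForm a)) (g : G) :
    normalForm a (coord a g) = g :=
  Function.rightInverse_invFun ha.surjective g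

/-- The action of a group element as an algebra endomorphism of the functions on the group. -/
def actHom (g : G) : (G → ℚ) →ₐ[ℚ] (G → ℚ) where
  toFun := act g
  map_one' := rfl
  map_mul' _ _ := rfl
  map_zero' := rfl
  map_add' _ _ := rfl
  commutes' _ := rfl

/-- The action is a right action, so the factor on the left of a product acts first. -/
theorem act_act (g g' : G) (f : G → ℚ) : act g (act g' f) = act (g' * g) f := by
  funext h
  simp [act, mul_assoc]

theorem act_one (f : G → ℚ) : act 1 f = f := by
  funext h
  simp [act]

theorem act_inv_act (g : G) (f : G → ℚ) : act g⁻¹ (act g f) = f := by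
  rw [act_act, mul_inv_cancel, act_one]

theorem coord_mem_coordModule (i : ι) : (fun h => (coord a h i : ℚ)) ∈ coordModule a :=
  Submodule.subset_span ⟨(1, i), act_one _⟩

theorem act_mem_coordModule (g : G) {f : G → ℚ} (hf : f ∈ coordModule a) :
    act g f ∈ coordModule a := by
  suffices h : coordModule a ≤ (coordModule a).comap (actHom g).toLinearMap from h hf
  refine Submodule.span_le.2 ?_
  rintro _ ⟨⟨g', i⟩, rfl⟩
  refine Submodule.subset_span ⟨(g' * g, i), ?_⟩
  exact (act_act g g' _).symm

/-- `polyFun` as an algebra homomorphism. -/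
noncomputable def polyFunHom (a : ι → G) : MvPolynomial ι ℚ →ₐ[ℚ] (G → ℚ) :=
  MvPolynomial.aeval fun i g => (coord a g i : ℚ)

theorem polyFunHom_apply (p : MvPolynomial ι ℚ) : polyFunHom a p = polyFun a p := by
  funext g
  have h : (Pi.evalAlgHom ℚ (fun _ : G => ℚ) g).comp (polyFunHom a) =
      MvPolynomial.aeval fun i => (coord a g i : ℚ) := by
    apply MvPolynomial.algHom_ext
    intro i
    simp [polyFunHom]
  have h1 := DFunLike.congr_fun h p
  rw [MvPolynomial.aeval_eq_eval] at h1
  exact h1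

theorem polyFun_X (i : ι) : polyFun a (MvPolynomial.X i) = fun h => (coord a h i : ℚ) := by
  funext h
  simp [polyFun]

/-- Coordinates range over all integer points, and a polynomial over `ℚ` is determined by its values
there. -/
theorem polyFunHom_injective (ha : Function.Bijective (normalForm a)) :
    Function.Injective (polyFunHom a) := by
  intro p p' h
  rw [polyFunHom_apply, polyFunHom_apply] at h
  refine MvPolynomial.funext_set (fun _ => Set.range ((↑) : ℤ → ℚ))
    (fun _ => Set.infinite_range_of_injective Int.cast_injective) fun x hx => ?_
  have hx' : ∀ i, ∃ z : ℤ, (z : ℚ) = x i := fun i => hx i trivial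
  choose z hz using hx'
  have h1 := congrFun h (normalForm a z)
  simp only [polyFun, coord_normalForm ha, hz] at h1
  exact h1

theorem normalForm_single (j : ι) (z : ℤ) :
    normalForm a (fun i => if i = j then z else 0) = a j ^ z :=
  prod_map_pow_single a _ (pairwise_indices.imp fun h => h.ne) j (mem_indices j) z

theorem coord_mul (ha : Function.Bijective (normalForm a)) (hq : IsMultiplicationPolynomials a q)
    (g h : G) (i : ι) :
    coord a (g * h) i = MvPolynomial.eval (Sum.elim (coord a g) (coord a h)) (q i) := by
  have h1 := hq (coord a g) (coord a h)
  rw [normalForm_coord ha, normalForm_coord ha] at h1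
  rw [h1, coord_normalForm ha]

/-- Right translations of polynomial functions are polynomial functions. -/
theorem polyFun_translate (ha : Function.Bijective (normalForm a))
    (hq : IsMultiplicationPolynomials a q) (g : G) (c : ι → MvPolynomial ι ℚ)
    -- The constants are kept as a variable `c` so that the result also matches the literal `-δ`
    -- substituted in `subst`.
    (hc : ∀ k, c k = MvPolynomial.C (coord a g⁻¹ k : ℚ)) (p : MvPolynomial ι ℚ) :
    polyFun a (MvPolynomial.aeval
      (fun i => MvPolynomial.aeval (Sum.elim MvPolynomial.X c) (q i)) p) =
      act g (polyFun a p) := by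
  funext h
  have hr (i : ι) : MvPolynomial.aeval (R := ℚ) (fun i => (coord a h i : ℚ))
      (MvPolynomial.aeval (R := ℤ) (Sum.elim MvPolynomial.X c) (q i)) =
        (coord a (h * g⁻¹) i : ℚ) := by
    have hr : (MvPolynomial.aeval (R := ℚ) fun i => (coord a h i : ℚ)).toRingHom.comp
        (MvPolynomial.aeval (R := ℤ) (Sum.elim MvPolynomial.X c)).toRingHom =
        (Int.castRingHom ℚ).comp
          (MvPolynomial.eval (Sum.elim (coord a h) (coord a g⁻¹))) := by
      apply MvPolynomial.ringHom_ext
      · intro r; simp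
      · rintro (k | k) <;> simp [hc]
    rw [coord_mul ha hq]
    exact DFunLike.congr_fun hr (q i)
  have h1 := DFunLike.congr_fun (MvPolynomial.comp_aeval
    (fun i => MvPolynomial.aeval (R := ℤ) (Sum.elim MvPolynomial.X c) (q i))
    (MvPolynomial.aeval (R := ℚ) fun i => (coord a h i : ℚ))) p
  simp only [hr] at h1
  simp only [polyFun, act, ← MvPolynomial.aeval_eq_eval]
  exact h1

theorem exists_polyFun_eq_act (ha : Function.Bijective (normalForm a))
    (hq : IsMultiplicationPolynomials a q) (g : G) (p : MvPolynomial ι ℚ) :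
    ∃ p', polyFun a p' = act g (polyFun a p) :=
  ⟨_, polyFun_translate ha hq g _ (fun _ => rfl) p⟩

theorem polyFun_subst (ha : Function.Bijective (normalForm a))
    (hq : IsMultiplicationPolynomials a q) (j : ι) (p : MvPolynomial ι ℚ) :
    polyFun a (subst q j p) = act (a j) (polyFun a p) := by
  refine polyFun_translate ha hq (a j) _ (fun k => ?_) p
  rw [← zpow_neg_one, ← normalForm_single, coord_normalForm ha]
  by_cases hk : k = j <;> simp [hk]

end Functions

/-! ### Correctness of Nickel's algorithm -/

section Correctness

variable {ι : Type} [Fintype ι] [LinearOrder ι] {G : Type} [Group G] {a : ι → G}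
  {q : ι → MvPolynomial (ι ⊕ ι) ℤ} {ord : LinearOrder (ι →₀ ℕ)}

/-- An injective endomorphism of a finite-dimensional space is onto. This is why the algorithm only
needs to apply `a_j` and never its inverse. -/
theorem act_inv_mem {V : Submodule ℚ (G → ℚ)} [FiniteDimensional ℚ V] {g : G}
    (hg : ∀ f ∈ V, act g f ∈ V) : ∀ f ∈ V, act g⁻¹ f ∈ V := by
  have hinj : Function.Injective (actHom g).toLinearMap := fun f f' h => by
    rw [← act_inv_act g f, ← act_inv_act g f']
    exact congrArg (act g⁻¹) h
  have h1 : V.map (actHom g).toLinearMap = V := by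
    refine Submodule.eq_of_le_of_finrank_eq ?_
      (Submodule.equivMapOfInjective _ hinj V).finrank_eq.symm
    rintro _ ⟨f, hf, rfl⟩
    exact hg f hf
  intro f hf
  rw [← h1] at hf
  obtain ⟨f', hf', rfl⟩ := hf
  change act g⁻¹ (act g f') ∈ V
  rwa [act_inv_act]

theorem act_pow_mem {V : Submodule ℚ (G → ℚ)} {g : G}
    (hg : ∀ f ∈ V, act g f ∈ V) (n : ℕ) : ∀ f ∈ V, act (g ^ n) f ∈ V := by
  induction n with
  | zero => intro f hf; rwa [pow_zero, act_one]
  | succ n ih => intro f hf; rw [pow_succ, ← act_act]; exact hg _ (ih f hf)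

theorem act_zpow_mem {V : Submodule ℚ (G → ℚ)} [FiniteDimensional ℚ V] {g : G}
    (hg : ∀ f ∈ V, act g f ∈ V) (z : ℤ) : ∀ f ∈ V, act (g ^ z) f ∈ V := by
  obtain ⟨n, rfl | rfl⟩ := z.eq_nat_or_neg
  · rw [zpow_natCast]; exact act_pow_mem hg n
  · rw [zpow_neg, zpow_natCast, ← inv_pow]; exact act_pow_mem (act_inv_mem hg) n

/-- The span of a list of polynomials, as a space of functions on the group. -/
noncomputable def funSpan (a : ι → G) (B : List (MvPolynomial ι ℚ)) : Submodule ℚ (G → ℚ) :=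
  (listSpan B).map (polyFunHom a).toLinearMap

theorem funSpan_mono {B B' : List (MvPolynomial ι ℚ)} (h : listSpan B ≤ listSpan B') :
    funSpan a B ≤ funSpan a B' := Submodule.map_mono h

theorem funSpan_eq_span (B : List (MvPolynomial ι ℚ)) :
    funSpan a B = Submodule.span ℚ (Set.range fun k : Fin B.length => polyFun a (B.get k)) := by
  rw [funSpan, listSpan, Submodule.map_span]
  congr 1
  ext f
  constructor
  · rintro ⟨p, hp, rfl⟩
    obtain ⟨k, rfl⟩ := List.mem_iff_get.1 hp
    exact ⟨k, (polyFunHom_apply _).symm⟩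
  · rintro ⟨k, rfl⟩
    exact ⟨B.get k, List.get_mem _ _, polyFunHom_apply _⟩

instance (B : List (MvPolynomial ι ℚ)) : FiniteDimensional ℚ (funSpan a B) := by
  rw [funSpan_eq_span]
  exact FiniteDimensional.span_of_finite ℚ (Set.finite_range _)

theorem act_mem_funSpan (ha : Function.Bijective (normalForm a))
    (hq : IsMultiplicationPolynomials a q) {j : ι} {B : List (MvPolynomial ι ℚ)}
    (hB : listSpan B ≤ (listSpan B).comap (substLin q j)) :
    ∀ f ∈ funSpan a B, act (a j) f ∈ funSpan a B := by
  rintro _ ⟨p, hp, rfl⟩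
  refine ⟨subst q j p, mem_comap_substLin.1 (hB hp), ?_⟩
  change polyFunHom a (subst q j p) = act (a j) (polyFunHom a p)
  rw [polyFunHom_apply, polyFunHom_apply, polyFun_subst ha hq]

/-- Only invariance under `a_j` immediately after its own pass is used: that pass absorbs the power
of `a_j`, and later passes only enlarge the span. Invariance under earlier generators need not be
tracked. -/
theorem ForLoop.act_mem (ha : Function.Bijective (normalForm a))
    (hq : IsMultiplicationPolynomials a q) {J : List ι} {B B' : List (MvPolynomial ι ℚ)} {c : ℕ}
    (h : ForLoop ord q J B B' c) (z : ι → ℤ) :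
    ∀ f ∈ funSpan a B, act ((J.map fun j => a j ^ z j).prod) f ∈ funSpan a B' := by
  induction h with
  | nil => intro f hf; simpa [act_one] using hf
  | @cons j J B B' B'' c d h h' ih =>
    intro f hf
    rw [List.map_cons, List.prod_cons, ← act_act]
    exact ih _ (act_zpow_mem (act_mem_funSpan ha hq h.invariant) _ _
      (funSpan_mono h.extends.span_le hf))

theorem act_mem_funSpan_of_run (ha : Function.Bijective (normalForm a))
    (hq : IsMultiplicationPolynomials a q) {B B' : List (MvPolynomial ι ℚ)} {c : ℕ}
    (h : ForLoop ord q (indices ι).reverse B B' c) (g : G) {f : G → ℚ} (hf : f ∈ funSpan a B) :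
    act g f ∈ funSpan a B' := by
  have h1 := h.act_mem ha hq (fun i => - coord a g⁻¹ i) f hf
  -- Inverting the normal form of `g⁻¹` writes `g` with the generators in the order `n, …, 1` in
  -- which the loop treats them.
  have h2 : ((indices ι).reverse.map fun j => a j ^ (-coord a g⁻¹ j)).prod = g := by
    conv_rhs => rw [← inv_inv g, ← normalForm_coord ha g⁻¹]
    rw [normalForm, List.prod_inv_reverse, List.map_reverse, List.map_map]
    simp [Function.comp_def]
  rwa [h2] at h1

theorem coordModule_le {W : Submodule ℚ (G → ℚ)}
    (h : ∀ g i, act g (fun h => (coord a h i : ℚ)) ∈ W) : coordModule a ≤ W := by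
  refine Submodule.span_le.2 ?_
  rintro _ ⟨⟨g, i⟩, rfl⟩
  exact h g i

/-- The polynomials that represent elements of the module generated by the coordinates. -/
noncomputable def coordPolynomials (a : ι → G) : Submodule ℚ (MvPolynomial ι ℚ) :=
  (coordModule a).comap (polyFunHom a).toLinearMap

theorem mem_coordPolynomials {p : MvPolynomial ι ℚ} :
    p ∈ coordPolynomials a ↔ polyFun a p ∈ coordModule a := by
  rw [← polyFunHom_apply]
  rfl

theorem finiteDimensional_coordPolynomials (ha : Function.Bijective (normalForm a))
    [FiniteDimensional ℚ (coordModule a)] : FiniteDimensional ℚ (coordPolynomials a) := by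
  let φ : coordPolynomials a →ₗ[ℚ] coordModule a :=
    (polyFunHom a).toLinearMap.restrict fun _ hp => hp
  refine Module.Finite.of_injective φ fun p p' h => ?_
  exact Subtype.ext (polyFunHom_injective ha (congrArg Subtype.val h))

theorem coordPolynomials_invariant (ha : Function.Bijective (normalForm a))
    (hq : IsMultiplicationPolynomials a q) (j : ι) :
    coordPolynomials a ≤ (coordPolynomials a).comap (substLin q j) := by
  intro p hp
  rw [mem_comap_substLin, mem_coordPolynomials, polyFun_subst ha hq]
  exact act_mem_coordModule _ (mem_coordPolynomials.1 hp)

theorem foldl_insertPoly_X (ord : LinearOrder (ι →₀ ℕ)) :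
    let B := ((indices ι).map (MvPolynomial.X (R := ℚ))).foldl (insertPoly ord) []
    IsReduced ord B ∧ B.length ≤ (indices ι).length ∧
      listSpan B = listSpan ((indices ι).map MvPolynomial.X) := by
  obtain ⟨h1, h2⟩ := foldl_insertPoly (ord := ord) ((indices ι).map (MvPolynomial.X (R := ℚ))) []
  refine ⟨h1.isReduced ⟨by simp, List.Pairwise.nil⟩, ?_, ?_⟩
  · simpa using h1.length_le
  · rw [h2]
    simp [listSpan]

theorem listSpan_X_le : listSpan ((indices ι).map (MvPolynomial.X (R := ℚ))) ≤
    coordPolynomials a := by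
  refine listSpan_le.2 fun p hp => ?_
  obtain ⟨i, -, rfl⟩ := List.mem_map.1 hp
  rw [mem_coordPolynomials, polyFun_X]
  exact coord_mem_coordModule i

theorem exists_run (ha : Function.Bijective (normalForm a))
    (hq : IsMultiplicationPolynomials a q) [FiniteDimensional ℚ (coordModule a)]
    (ord : LinearOrder (ι →₀ ℕ)) : ∃ B c, Run ord q B c := by
  have := finiteDimensional_coordPolynomials ha
  obtain ⟨h1, -, h2⟩ := foldl_insertPoly_X ord
  obtain ⟨B, d, h⟩ := exists_forLoop (coordPolynomials_invariant ha hq) (indices ι).reverse _ h1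
    (h2.trans_le listSpan_X_le)
  exact ⟨B, _, d, h, rfl⟩

theorem Run.length_le {B : List (MvPolynomial ι ℚ)} {c : ℕ} (h : Run ord q B c) :
    B.length ≤ c := by
  obtain ⟨d, h, rfl⟩ := h
  have h1 := (foldl_insertPoly_X ord).2.1
  have h2 := h.extends.length_le
  omega

theorem Run.linearIndependent (ha : Function.Bijective (normalForm a))
    {B : List (MvPolynomial ι ℚ)} {c : ℕ} (h : Run ord q B c) :
    LinearIndependent ℚ fun k : Fin B.length => polyFun a (B.get k) := by
  obtain ⟨d, h, -⟩ := h
  have h1 := (h.extends.isReduced (foldl_insertPoly_X ord).1).linearIndependent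
  have h2 := h1.map' (polyFunHom a).toLinearMap (LinearMap.ker_eq_bot.2 (polyFunHom_injective ha))
  have h3 : (fun k : Fin B.length => polyFun a (B.get k)) =
      (polyFunHom a).toLinearMap ∘ fun k => B.get k :=
    funext fun k => (polyFunHom_apply _).symm
  rw [h3]
  exact h2

theorem Run.span_eq (ha : Function.Bijective (normalForm a))
    (hq : IsMultiplicationPolynomials a q) {B : List (MvPolynomial ι ℚ)} {c : ℕ}
    (h : Run ord q B c) :
    Submodule.span ℚ (Set.range fun k : Fin B.length => polyFun a (B.get k)) = coordModule a := by
  obtain ⟨d, h, -⟩ := h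
  have h1 := (foldl_insertPoly_X ord).2.2
  rw [← funSpan_eq_span]
  apply le_antisymm
  · rw [funSpan, Submodule.map_le_iff_le_comap]
    exact h.span_le (coordPolynomials_invariant ha hq) (h1.trans_le listSpan_X_le)
  · refine coordModule_le fun g i => act_mem_funSpan_of_run ha hq h g ?_
    refine ⟨MvPolynomial.X i, ?_, ?_⟩
    · rw [h1]
      exact mem_listSpan (List.mem_map.2 ⟨i, mem_indices i, rfl⟩)
    · change polyFunHom a _ = _
      rw [polyFunHom_apply, polyFun_X]

end Correctness

/-! ### Elimination in unitriangular matrices -/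

section Elimination

variable {m : ℕ} {R : Type} [CommRing R]

theorem UpperPair.lt_iff {p p' : UpperPair m} : p < p' ↔
    (p.col : ℕ) - p.row < p'.col - p'.row ∨
      (p.col : ℕ) - p.row = p'.col - p'.row ∧ (p.row : ℕ) < p'.row :=
  Prod.Lex.lt_iff

theorem UpperPair.lt_of_length_lt {p p' : UpperPair m}
    (h : (p.col : ℕ) - p.row < p'.col - p'.row) : p < p' := UpperPair.lt_iff.2 (Or.inl h)

/-- Upper triangular matrices with ones on the diagonal, over any commutative ring. -/
structure IsUnitriangular (M : Matrix (Fin m) (Fin m) R) : Prop where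
  lower : ∀ i j, j < i → M i j = 0
  diag : ∀ i, M i i = 1

theorem transvection_mul_apply (i j : Fin m) (c : R) (M : Matrix (Fin m) (Fin m) R)
    (k l : Fin m) :
    (Matrix.transvection i j c * M) k l = M k l + if k = i then c * M j l else 0 := by
  by_cases h : k = i
  · subst h
    rw [Matrix.transvection_mul_apply_same, if_pos rfl]
  · rw [Matrix.transvection_mul_apply_of_ne _ _ _ _ h, if_neg h, add_zero]

theorem IsUnitriangular.one : IsUnitriangular (1 : Matrix (Fin m) (Fin m) R) :=
  ⟨fun _ _ h => Matrix.one_apply_ne h.ne', fun i => Matrix.one_apply_eq i⟩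

theorem IsUnitriangular.transvection_mul {M : Matrix (Fin m) (Fin m) R} (hM : IsUnitriangular M)
    (p : UpperPair m) (c : R) :
    IsUnitriangular (Matrix.transvection p.row p.col c * M) := by
  refine ⟨fun i j h => ?_, fun i => ?_⟩ <;> rw [transvection_mul_apply]
  · rw [hM.lower i j h, zero_add]
    split_ifs with hi
    · rw [hM.lower _ _ (h.trans (hi ▸ p.lt)), mul_zero]
    · rfl
  · rw [hM.diag, add_eq_left]
    split_ifs with hi
    · rw [hM.lower _ _ (hi ▸ p.lt), mul_zero]
    · rfl

/-- The ordered product of the elementary matrices with entry `x p` at the positions `p` of a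
list. -/
def matProd (l : List (UpperPair m)) (x : UpperPair m → R) : Matrix (Fin m) (Fin m) R :=
  (l.map fun p => Matrix.transvection p.row p.col (x p)).prod

theorem matProd_cons (p : UpperPair m) (l : List (UpperPair m)) (x : UpperPair m → R) :
    matProd (p :: l) x = Matrix.transvection p.row p.col (x p) * matProd l x := rfl

/-- The exponents found by clearing the entries at the positions of a list one after the other. -/
def elim : List (UpperPair m) → Matrix (Fin m) (Fin m) R → UpperPair m → R
  | [], _ => 0
  | p :: l, M => Function.update
      (elim l (Matrix.transvection p.row p.col (-M p.row p.col) * M)) p (M p.row p.col)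

/-- The list is an increasing enumeration of an upper set of positions. -/
structure IsUpperList (l : List (UpperPair m)) : Prop where
  pairwise : l.Pairwise (· < ·)
  upper : ∀ q ∉ l, ∀ p ∈ l, q < p

theorem IsUpperList.tail {p : UpperPair m} {l : List (UpperPair m)} (h : IsUpperList (p :: l)) :
    IsUpperList l := by
  obtain ⟨h1, h2⟩ := List.pairwise_cons.1 h.pairwise
  refine ⟨h2, fun q hq p' hp' => ?_⟩
  by_cases hqp : q = p
  · rw [hqp]; exact h1 p' hp'
  · exact h.upper q (by simp [hq, hqp]) p' (List.mem_cons_of_mem _ hp')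

theorem IsUpperList.not_mem {p : UpperPair m} {l : List (UpperPair m)}
    (h : IsUpperList (p :: l)) : p ∉ l :=
  fun hp => lt_irrefl p ((List.pairwise_cons.1 h.pairwise).1 p hp)

theorem isUpperList_indices : IsUpperList (indices (UpperPair m)) :=
  ⟨pairwise_indices, fun q hq => absurd (mem_indices q) hq⟩

theorem isUnitriangular_matProd (l : List (UpperPair m)) (x : UpperPair m → R) :
    IsUnitriangular (matProd l x) := by
  induction l with
  | nil => exact IsUnitriangular.one
  | cons p l ih => exact ih.transvection_mul p _

theorem matProd_congr {l : List (UpperPair m)} {x y : UpperPair m → R} (h : ∀ p ∈ l, x p = y p) :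
    matProd l x = matProd l y := by
  rw [matProd, matProd, List.map_congr_left fun p hp => by rw [h p hp]]

/-- Only row `p.row` changes. An earlier position in that row has a smaller column, and the entry of
row `p.col` added there lies below the diagonal. Thus clearing positions in order never disturbs
those already cleared. -/
theorem entry_transvection_mul {M : Matrix (Fin m) (Fin m) R} (hM : IsUnitriangular M)
    {p q : UpperPair m} (hqp : q < p) (c : R) :
    (Matrix.transvection p.row p.col c * M) q.row q.col = M q.row q.col := by
  rw [transvection_mul_apply, add_eq_left]
  split_ifs with h
  · rw [hM.lower, mul_zero]
    have h1 := UpperPair.lt_iff.1 hqp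
    have h2 : (p.row : ℕ) < p.col := p.lt
    have h3 : (q.row : ℕ) < q.col := q.lt
    rw [h] at h1 h3
    rw [Fin.lt_def]
    omega
  · rfl

theorem matProd_entry_of_not_mem {l : List (UpperPair m)} (hl : IsUpperList l)
    (x : UpperPair m → R) {q : UpperPair m} (hq : q ∉ l) : matProd l x q.row q.col = 0 := by
  induction l with
  | nil => exact Matrix.one_apply_ne q.lt.ne
  | cons p l ih =>
    rw [matProd_cons, entry_transvection_mul (isUnitriangular_matProd l x)
      (hl.upper q hq p List.mem_cons_self)]
    exact ih hl.tail fun h => hq (List.mem_cons_of_mem _ h)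

theorem matProd_cons_entry {p : UpperPair m} {l : List (UpperPair m)} (hl : IsUpperList (p :: l))
    (x : UpperPair m → R) : matProd (p :: l) x p.row p.col = x p := by
  rw [matProd_cons, transvection_mul_apply, if_pos rfl, (isUnitriangular_matProd l x).diag,
    matProd_entry_of_not_mem hl.tail x hl.not_mem]
  ring

theorem transvection_neg_mul (p : UpperPair m) (c : R) (M : Matrix (Fin m) (Fin m) R) :
    Matrix.transvection p.row p.col (-c) * (Matrix.transvection p.row p.col c * M) = M := by
  rw [← mul_assoc, Matrix.transvection_mul_transvection_same _ _ p.lt.ne, neg_add_cancel,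
    Matrix.transvection_zero, one_mul]

theorem elim_matProd {l : List (UpperPair m)} (hl : IsUpperList l) (x : UpperPair m → R)
    {p : UpperPair m} (hp : p ∈ l) : elim l (matProd l x) p = x p := by
  induction l with
  | nil => simp at hp
  | cons p' l ih =>
    rw [elim, matProd_cons_entry hl, matProd_cons, transvection_neg_mul]
    by_cases h : p = p'
    · subst h
      rw [Function.update_self]
    · rw [Function.update_of_ne h]
      exact ih hl.tail ((List.mem_cons.1 hp).resolve_left h)

theorem matProd_elim {l : List (UpperPair m)} (hl : IsUpperList l)
    {M : Matrix (Fin m) (Fin m) R} (hM : IsUnitriangular M)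
    (h0 : ∀ q ∉ l, M q.row q.col = 0) : matProd l (elim l M) = M := by
  induction l generalizing M with
  | nil =>
    ext i j
    rw [matProd, List.map_nil, List.prod_nil]
    rcases lt_trichotomy i j with h | rfl | h
    · rw [Matrix.one_apply_ne h.ne]
      exact (h0 ⟨i, j, h⟩ (by simp)).symm
    · rw [Matrix.one_apply_eq, hM.diag]
    · rw [Matrix.one_apply_ne h.ne', hM.lower i j h]
  | cons p l ih =>
    have hc : matProd l (elim (p :: l) M) =
        matProd l (elim l (Matrix.transvection p.row p.col (-M p.row p.col) * M)) := by
      refine matProd_congr fun q hq => ?_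
      rw [elim, Function.update_of_ne]
      rintro rfl
      exact hl.not_mem hq
    rw [matProd_cons, hc, ih hl.tail (hM.transvection_mul p _), elim, Function.update_self]
    · have h := transvection_neg_mul p (-M p.row p.col) M
      rwa [neg_neg] at h
    · intro q hq
      by_cases hqp : q = p
      · subst hqp
        rw [transvection_mul_apply, if_pos rfl, hM.diag]
        ring
      · have hq' : q ∉ p :: l := by simp [hq, hqp]
        rw [entry_transvection_mul hM (hl.upper q hq' p List.mem_cons_self), h0 q hq']

variable {R' : Type} [CommRing R']

theorem map_transvection (f : R →+* R') (i j : Fin m) (c : R) :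
    f.mapMatrix (Matrix.transvection i j c) = Matrix.transvection i j (f c) := by
  rw [Matrix.transvection, Matrix.transvection, map_add, map_one, RingHom.mapMatrix_apply,
    Matrix.map_single]

theorem map_matProd (f : R →+* R') (l : List (UpperPair m)) (x : UpperPair m → R) :
    f.mapMatrix (matProd l x) = matProd l fun p => f (x p) := by
  rw [matProd, map_list_prod, List.map_map, matProd]
  simp only [Function.comp_def, map_transvection]

/-- Elimination uses only ring operations. Run on a product of two generic matrices it therefore
yields the multiplication polynomials, and run on matrix entries as functions it shows that
coordinates are polynomials in them. -/
theorem map_elim (f : R →+* R') (l : List (UpperPair m)) (M : Matrix (Fin m) (Fin m) R)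
    (p : UpperPair m) : elim l (f.mapMatrix M) p = f (elim l M p) := by
  induction l generalizing M with
  | nil => simp [elim]
  | cons p' l ih =>
    rw [elim, elim]
    by_cases h : p = p'
    · subst h
      simp
    · rw [Function.update_of_ne h, Function.update_of_ne h, ← ih, map_mul, map_transvection]
      simp

end Elimination

/-! ### The coordinates of the unitriangular group -/

section Coordinates

variable {m : ℕ}

/-- The matrix of an element of `UT m`. -/
def toMat (g : UT m) : Matrix (Fin m) (Fin m) ℤ := g.val.val

theorem toMat_injective : Function.Injective (toMat (m := m)) :=
  Units.val_injective.comp Subtype.val_injective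

theorem toMat_mul (g h : UT m) : toMat (g * h) = toMat g * toMat h := rfl

theorem toMat_one : toMat (1 : UT m) = 1 := rfl

theorem isUnitriangular_toMat (g : UT m) : IsUnitriangular (toMat g) := ⟨g.2.1, g.2.2⟩

theorem toMat_s (p : UpperPair m) : toMat (s p) = Matrix.transvection p.row p.col 1 := rfl

theorem toMat_s_inv (p : UpperPair m) : toMat (s p)⁻¹ = Matrix.transvection p.row p.col (-1) := rfl

theorem toMat_s_zpow (p : UpperPair m) (z : ℤ) :
    toMat (s p ^ z) = Matrix.transvection p.row p.col z := by
  induction z using Int.induction_on with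
  | zero => rw [zpow_zero, toMat_one, Matrix.transvection_zero]
  | succ n ih =>
    rw [zpow_add_one, toMat_mul, ih, toMat_s,
      Matrix.transvection_mul_transvection_same _ _ p.lt.ne]
  | pred n ih =>
    rw [zpow_sub_one, toMat_mul, ih, toMat_s_inv,
      Matrix.transvection_mul_transvection_same _ _ p.lt.ne, sub_eq_add_neg]

theorem toMat_list_prod (l : List (UT m)) : toMat l.prod = (l.map toMat).prod := by
  induction l with
  | nil => rfl
  | cons g l ih => rw [List.prod_cons, toMat_mul, ih, List.map_cons, List.prod_cons]

theorem toMat_prod_zpow (l : List (UpperPair m)) (x : UpperPair m → ℤ) :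
    toMat (l.map fun p => s p ^ x p).prod = matProd l x := by
  rw [toMat_list_prod, List.map_map, matProd]
  simp only [Function.comp_def, toMat_s_zpow]

theorem toMat_normalForm (x : UpperPair m → ℤ) :
    toMat (normalForm s x) = matProd (indices (UpperPair m)) x :=
  toMat_prod_zpow _ x

theorem normalForm_elim (g : UT m) :
    normalForm s (elim (indices (UpperPair m)) (toMat g)) = g := by
  apply toMat_injective
  rw [toMat_normalForm]
  exact matProd_elim isUpperList_indices (isUnitriangular_toMat g)
    fun q hq => absurd (mem_indices q) hq

theorem normalForm_bijective : Function.Bijective (normalForm (s (m := m))) := by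
  refine ⟨fun x y h => ?_, fun g => ⟨_, normalForm_elim g⟩⟩
  funext p
  rw [← elim_matProd isUpperList_indices x (mem_indices p),
    ← elim_matProd isUpperList_indices y (mem_indices p), ← toMat_normalForm, h,
    toMat_normalForm]

theorem coord_eq_elim (g : UT m) :
    coord s g = elim (indices (UpperPair m)) (toMat g) := by
  conv_lhs => rw [← normalForm_elim g]
  exact coord_normalForm normalForm_bijective _

theorem existsUnique_multiplicationPolynomials :
    ∃! q, IsMultiplicationPolynomials (s (m := m)) q := by
  let M : Matrix (Fin m) (Fin m) (MvPolynomial (UpperPair m ⊕ UpperPair m) ℤ) :=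
    matProd (indices (UpperPair m)) (fun p => MvPolynomial.X (Sum.inl p)) *
      matProd (indices (UpperPair m)) (fun p => MvPolynomial.X (Sum.inr p))
  refine ⟨fun p => elim (indices (UpperPair m)) M p, fun x y => ?_, fun q hq => ?_⟩
  · conv_lhs => rw [← normalForm_elim (normalForm s x * normalForm s y)]
    congr 1
    funext p
    rw [← map_elim, map_mul, map_matProd, map_matProd, toMat_mul, toMat_normalForm,
      toMat_normalForm]
    simp
  · funext p
    -- Uniqueness: integer polynomials that agree at all integer points are equal.
    refine MvPolynomial.funext fun z => ?_
    rw [← Sum.elim_comp_inl_inr z, ← map_elim, map_mul, map_matProd, map_matProd]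
    simp only [MvPolynomial.eval_X, Sum.elim_inl, Sum.elim_inr]
    rw [← toMat_normalForm, ← toMat_normalForm, ← toMat_mul, hq, ← coord_eq_elim,
      coord_normalForm normalForm_bijective]

/-! ### The standard Mal'cev basis -/

theorem UpperPair.row_le {r j c : Fin m} (h : r < j) (hj : j ≤ c) :
    (⟨r, j, h⟩ : UpperPair m) ≤ ⟨r, c, h.trans_le hj⟩ := by
  rcases hj.eq_or_lt with rfl | hj
  · exact le_rfl
  · refine (UpperPair.lt_of_length_lt ?_).le
    rw [Fin.lt_def] at h hj
    dsimp only
    omega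

theorem UpperPair.col_le {r j c : Fin m} (hj : r ≤ j) (h : j < c) :
    (⟨j, c, h⟩ : UpperPair m) ≤ ⟨r, c, hj.trans_lt h⟩ := by
  rcases hj.eq_or_lt with rfl | hj
  · exact le_rfl
  · refine (UpperPair.lt_of_length_lt ?_).le
    rw [Fin.lt_def] at h hj
    dsimp only
    omega

/-- Two elements of `UT m` have the same entries at the positions of a lower set. -/
def Agree (L : LowerSet (UpperPair m)) (g h : UT m) : Prop :=
  ∀ q ∈ L, toMat g q.row q.col = toMat h q.row q.col

/-- The entry `(r, c)` of `g * k` involves only entries `(r, j)` of `g` with `j ≤ c`, and these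
positions do not come after `(r, c)`. With the left-hand version, agreement is a congruence, so
`vanishing L` is normal. -/
theorem Agree.mul_right {L : LowerSet (UpperPair m)} {g g' : UT m} (h : Agree L g g') (k : UT m) :
    Agree L (g * k) (g' * k) := by
  rintro ⟨r, c, hrc⟩ hq
  rw [toMat_mul, toMat_mul, Matrix.mul_apply, Matrix.mul_apply]
  refine Finset.sum_congr rfl fun j _ => ?_
  rcases lt_trichotomy r j with hrj | rfl | hrj
  · rcases le_or_gt j c with hjc | hjc
    · rw [h ⟨r, j, hrj⟩ (L.lower (UpperPair.row_le hrj hjc) hq)]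
    · rw [(isUnitriangular_toMat k).lower _ _ hjc, mul_zero, mul_zero]
  · rw [(isUnitriangular_toMat g).diag, (isUnitriangular_toMat g').diag]
  · rw [(isUnitriangular_toMat g).lower _ _ hrj, (isUnitriangular_toMat g').lower _ _ hrj]

theorem Agree.mul_left {L : LowerSet (UpperPair m)} {g g' : UT m} (h : Agree L g g') (k : UT m) :
    Agree L (k * g) (k * g') := by
  rintro ⟨r, c, hrc⟩ hq
  rw [toMat_mul, toMat_mul, Matrix.mul_apply, Matrix.mul_apply]
  refine Finset.sum_congr rfl fun j _ => ?_
  rcases lt_trichotomy j c with hjc | rfl | hjc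
  · rcases le_or_gt r j with hrj | hrj
    · rw [h ⟨j, c, hjc⟩ (L.lower (UpperPair.col_le hrj hjc) hq)]
    · rw [(isUnitriangular_toMat k).lower _ _ hrj, zero_mul, zero_mul]
  · rw [(isUnitriangular_toMat g).diag, (isUnitriangular_toMat g').diag]
  · rw [(isUnitriangular_toMat g).lower _ _ hjc, (isUnitriangular_toMat g').lower _ _ hjc]

/-- The elements of `UT m` whose entries at the positions of a lower set vanish. -/
def vanishing (L : LowerSet (UpperPair m)) : Subgroup (UT m) where
  carrier := {g | Agree L g 1}
  one_mem' := fun _ _ => rfl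
  mul_mem' := by
    intro g h hg hh q hq
    rw [hg.mul_right h q hq, one_mul, hh q hq]
  inv_mem' := by
    intro g hg q hq
    have h := hg.mul_right g⁻¹ q hq
    rw [mul_inv_cancel, one_mul] at h
    exact h.symm

theorem mem_vanishing {L : LowerSet (UpperPair m)} {g : UT m} :
    g ∈ vanishing L ↔ ∀ q ∈ L, toMat g q.row q.col = 0 := by
  have h (q : UpperPair m) : toMat (1 : UT m) q.row q.col = 0 := Matrix.one_apply_ne q.lt.ne
  exact forall₂_congr fun q _ => by rw [h]

instance (L : LowerSet (UpperPair m)) : (vanishing L).Normal := by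
  refine ⟨fun g hg k q hq => ?_⟩
  rw [(Agree.mul_left hg k).mul_right k⁻¹ q hq, mul_one, mul_inv_cancel]

theorem s_entry (p q : UpperPair m) :
    toMat (s p) q.row q.col = if q = p then 1 else 0 := by
  rw [toMat_s, Matrix.transvection, Matrix.add_apply, Matrix.one_apply_ne q.lt.ne, zero_add,
    Matrix.single_apply]
  have h : (p.row = q.row ∧ p.col = q.col) ↔ q = p :=
    ⟨fun h => UpperPair.ext h.1.symm h.2.symm, fun h => by rw [h]; exact ⟨rfl, rfl⟩⟩
  simp only [h]

/-- Elimination restricted to the positions outside `L` writes a matrix vanishing on `L` as a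
product of powers of the corresponding generators. This turns the subgroups of the central series
into vanishing conditions. -/
theorem closure_image_s (L : LowerSet (UpperPair m)) :
    Subgroup.closure (s '' (L : Set (UpperPair m))ᶜ) = vanishing L := by
  classical
  apply le_antisymm
  · rw [Subgroup.closure_le]
    rintro _ ⟨p, hp, rfl⟩
    refine mem_vanishing.2 fun q hq => ?_
    rw [s_entry, if_neg]
    rintro rfl
    exact hp hq
  · intro g hg
    have hmem (q : UpperPair m) :
        q ∈ (indices (UpperPair m)).filter (· ∉ L) ↔ q ∉ L := by
      simp [mem_indices]
    have hl : IsUpperList ((indices (UpperPair m)).filter (· ∉ L)) := by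
      refine ⟨List.Pairwise.filter _ pairwise_indices,
        fun q hq p hp => lt_of_not_ge fun h => ?_⟩
      rw [hmem] at hp hq
      exact hp (L.lower h (not_not.1 hq))
    have h := matProd_elim hl (isUnitriangular_toMat g) fun q hq =>
      mem_vanishing.1 hg q (not_not.1 (mt (hmem q).2 hq))
    rw [← toMat_prod_zpow] at h
    rw [← toMat_injective h]
    refine Subgroup.list_prod_mem _ fun k hk => ?_
    obtain ⟨p, hp, rfl⟩ := List.mem_map.1 hk
    have hp' : p ∈ (L : Set (UpperPair m))ᶜ := (hmem p).1 hp
    exact Subgroup.zpow_mem _ (Subgroup.subset_closure (Set.mem_image_of_mem s hp')) _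

theorem closure_image_Ici (p : UpperPair m) :
    Subgroup.closure (s '' Set.Ici p) = vanishing (LowerSet.Iio p) := by
  rw [← closure_image_s, LowerSet.coe_Iio, Set.compl_Iio]

theorem closure_image_Ioi (p : UpperPair m) :
    Subgroup.closure (s '' Set.Ioi p) = vanishing (LowerSet.Iic p) := by
  rw [← closure_image_s, LowerSet.coe_Iic, Set.compl_Iic]

/-- At `(r, c) ≤ p` the mixed terms of both products contain entries of `g` on shorter diagonals,
which vanish; the entries simply add. -/
theorem agree_mul_comm {p : UpperPair m} {g : UT m} (hg : g ∈ vanishing (LowerSet.Iio p))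
    (h : UT m) : Agree (LowerSet.Iic p) (g * h) (h * g) := by
  have hg' := mem_vanishing.1 hg
  rintro ⟨r, c, hrc⟩ hq
  have hzero {i j : Fin m} (hij : i < j) (hlen : (j : ℕ) - i < c - r) : toMat g i j = 0 :=
    hg' ⟨i, j, hij⟩ ((UpperPair.lt_of_length_lt hlen).trans_le hq)
  rw [toMat_mul, toMat_mul, Matrix.mul_apply, Matrix.mul_apply]
  have hrc' : (r : ℕ) < c := hrc
  have h1 : ∑ j, toMat g r j * toMat h j c = toMat h r c + toMat g r c := by
    rw [← Finset.sum_subset (Finset.subset_univ {r, c}), Finset.sum_pair hrc.ne,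
      (isUnitriangular_toMat g).diag, (isUnitriangular_toMat h).diag, one_mul, mul_one]
    intro j _ hj
    simp only [Finset.mem_insert, Finset.mem_singleton, not_or] at hj
    rcases lt_or_gt_of_ne hj.1 with hjr | hjr
    · rw [(isUnitriangular_toMat g).lower _ _ hjr, zero_mul]
    · rcases lt_or_gt_of_ne hj.2 with hjc | hjc
      · have hjc' : (j : ℕ) < c := hjc
        have hjr' : (r : ℕ) < j := hjr
        rw [hzero hjr (by omega), zero_mul]
      · rw [(isUnitriangular_toMat h).lower _ _ hjc, mul_zero]
  have h2 : ∑ j, toMat h r j * toMat g j c = toMat g r c + toMat h r c := by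
    rw [← Finset.sum_subset (Finset.subset_univ {r, c}), Finset.sum_pair hrc.ne,
      (isUnitriangular_toMat g).diag, (isUnitriangular_toMat h).diag, one_mul, mul_one]
    intro j _ hj
    simp only [Finset.mem_insert, Finset.mem_singleton, not_or] at hj
    rcases lt_or_gt_of_ne hj.1 with hjr | hjr
    · rw [(isUnitriangular_toMat h).lower _ _ hjr, zero_mul]
    · rcases lt_or_gt_of_ne hj.2 with hjc | hjc
      · have hjc' : (j : ℕ) < c := hjc
        have hjr' : (r : ℕ) < j := hjr
        rw [hzero hjc (by omega), mul_zero]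
      · rw [(isUnitriangular_toMat g).lower _ _ hjc, mul_zero]
  rw [h1, h2, add_comm]

theorem isMalcevBasis_s : IsMalcevBasis (s (m := m)) where
  bijective := normalForm_bijective
  normal p := by
    rw [closure_image_Ici]
    infer_instance
  strict p := by
    rw [closure_image_Ici, closure_image_Ioi]
    refine lt_of_le_of_ne (fun g hg q hq =>
      hg q (LowerSet.mem_Iic_iff.2 (le_of_lt (LowerSet.mem_Iio_iff.1 hq)))) fun h => ?_
    have h1 : s p ∈ vanishing (LowerSet.Iio p) := by
      rw [← closure_image_Ici]
      exact Subgroup.subset_closure ⟨p, Set.self_mem_Ici, rfl⟩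
    rw [← h] at h1
    have h2 := mem_vanishing.1 h1 p (le_refl p)
    rw [s_entry, if_pos rfl] at h2
    exact one_ne_zero h2
  central p := by
    rw [closure_image_Ici, closure_image_Ioi, Subgroup.commutator_le]
    intro g hg h _ q hq
    have h1 := (agree_mul_comm hg h).mul_right (h * g)⁻¹ q hq
    rwa [mul_inv_cancel, mul_inv_rev, ← mul_assoc] at h1

end Coordinates

/-! ### The module of coordinate functions is finite-dimensional -/

section Finiteness

/-- The functions that lie in a finite-dimensional invariant space form a subalgebra. -/
def locallyFinite (G : Type) [Group G] : Subalgebra ℚ (G → ℚ) where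
  carrier := {f | ∃ W : Submodule ℚ (G → ℚ), W.FG ∧ (∀ g, ∀ f ∈ W, act g f ∈ W) ∧ f ∈ W}
  mul_mem' := by
    rintro f f' ⟨W, h1, h2, h3⟩ ⟨W', h1', h2', h3'⟩
    -- Translation is an algebra homomorphism, so the product of two invariant spaces is invariant.
    refine ⟨W * W', h1.mul h1', fun g => ?_, Submodule.mul_mem_mul h3 h3'⟩
    suffices h : W * W' ≤ (W * W').comap (actHom g).toLinearMap from h
    exact Submodule.mul_le.2 fun x hx y hy => Submodule.mul_mem_mul (h2 g x hx) (h2' g y hy)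
  add_mem' := by
    rintro f f' ⟨W, h1, h2, h3⟩ ⟨W', h1', h2', h3'⟩
    refine ⟨W ⊔ W', h1.sup h1', fun g => ?_,
      Submodule.add_mem _ (Submodule.mem_sup_left h3) (Submodule.mem_sup_right h3')⟩
    suffices h : W ⊔ W' ≤ (W ⊔ W').comap (actHom g).toLinearMap from h
    exact sup_le (fun x hx => Submodule.mem_sup_left (h2 g x hx))
      fun x hx => Submodule.mem_sup_right (h2' g x hx)
  algebraMap_mem' := by
    intro r
    refine ⟨Submodule.span ℚ {algebraMap ℚ (G → ℚ) r}, Submodule.fg_span_singleton _,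
      fun g => ?_, Submodule.mem_span_singleton_self _⟩
    suffices h : Submodule.span ℚ {algebraMap ℚ (G → ℚ) r} ≤
        (Submodule.span ℚ {algebraMap ℚ (G → ℚ) r}).comap (actHom g).toLinearMap from h
    rw [Submodule.span_singleton_le_iff_mem]
    exact Submodule.mem_span_singleton_self (algebraMap ℚ (G → ℚ) r)

theorem finiteDimensional_coordModule_of_mem {ι : Type} [Fintype ι] [LinearOrder ι] {G : Type}
    [Group G] {a : ι → G} (h : ∀ i, (fun g => (coord a g i : ℚ)) ∈ locallyFinite G) :
    FiniteDimensional ℚ (coordModule a) := by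
  choose W h1 h2 h3 using h
  have hfg : (⨆ i, W i).FG := Submodule.fg_iSup W h1
  have : FiniteDimensional ℚ (⨆ i, W i : Submodule ℚ (G → ℚ)) :=
    Module.Finite.iff_fg.2 hfg
  refine Submodule.finiteDimensional_of_le (S₂ := ⨆ i, W i) (coordModule_le fun g i => ?_)
  exact Submodule.mem_iSup_of_mem i (h2 i g _ (h3 i))

variable {m : ℕ}

theorem entry_mem_locallyFinite (i j : Fin m) :
    (fun g => (toMat g i j : ℚ)) ∈ locallyFinite (UT m) := by
  obtain ⟨W, hW⟩ : ∃ W, W = Submodule.span ℚ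
    (Set.range fun (k : Fin m) (g : UT m) => (toMat g i k : ℚ)) := ⟨_, rfl⟩
  have hmem (k : Fin m) : (fun g : UT m => (toMat g i k : ℚ)) ∈ W :=
    hW ▸ Submodule.subset_span ⟨k, rfl⟩
  refine ⟨W, hW ▸ Submodule.fg_span (Set.finite_range _), fun g => ?_, hmem j⟩
  suffices h : W ≤ W.comap (actHom g).toLinearMap from h
  nth_rewrite 1 [hW]
  rw [Submodule.span_le]
  rintro _ ⟨k, rfl⟩
  -- Right translation combines the columns, so the entries of a fixed row span an invariant space.
  have h1 : act g (fun g => (toMat g i k : ℚ)) =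
      ∑ l, (toMat g⁻¹ l k : ℚ) • fun g : UT m => (toMat g i l : ℚ) := by
    funext h
    rw [act, toMat_mul, Matrix.mul_apply, Finset.sum_apply]
    push_cast
    exact Finset.sum_congr rfl fun l _ => mul_comm _ _
  change act g (fun g => (toMat g i k : ℚ)) ∈ W
  rw [h1]
  exact Submodule.sum_mem _ fun l _ => Submodule.smul_mem _ _ (hmem l)

theorem elim_mem {R : Type} [CommRing R] {S : Subring R} (l : List (UpperPair m))
    (M : Matrix (Fin m) (Fin m) R) (hM : ∀ i j, M i j ∈ S) (p : UpperPair m) :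
    elim l M p ∈ S := by
  induction l generalizing M with
  | nil => exact S.zero_mem
  | cons p' l ih =>
    rw [elim]
    by_cases h : p = p'
    · subst h
      rw [Function.update_self]
      exact hM _ _
    · rw [Function.update_of_ne h]
      refine ih _ fun i j => ?_
      rw [transvection_mul_apply]
      refine S.add_mem (hM _ _) ?_
      split_ifs
      · exact S.mul_mem (S.neg_mem (hM _ _)) (hM _ _)
      · exact S.zero_mem

theorem coord_mem_locallyFinite (p : UpperPair m) :
    (fun g => (coord s g p : ℚ)) ∈ locallyFinite (UT m) := by
  have h := elim_mem (S := (locallyFinite (UT m)).toSubring) (indices (UpperPair m))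
    (fun i j g => (toMat g i j : ℚ)) entry_mem_locallyFinite p
  convert (Subalgebra.mem_toSubring.1 h) using 1
  funext g
  have h1 := map_elim (Int.castRingHom ℚ) (indices (UpperPair m)) (toMat g) p
  have h2 := map_elim (Pi.evalRingHom (fun _ : UT m => ℚ) g) (indices (UpperPair m))
    (fun i j g => (toMat g i j : ℚ)) p
  rw [coord_eq_elim]
  exact h1.symm.trans h2

instance : FiniteDimensional ℚ (coordModule (s (m := m))) :=
  finiteDimensional_coordModule_of_mem coord_mem_locallyFinite

end Finiteness

/-! ### Coordinates of some products -/

section Products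

/-- Every factor satisfying `P` is moved to the right, past later factors that do not satisfy `P`;
only these pairs have to commute. -/
theorem prod_map_eq_mul {α M : Type} [Monoid M] (f : α → M) (P : α → Prop) [DecidablePred P]
    (l : List α)
    (hl : l.Pairwise fun p q => P p → ¬ P q → Commute (f p) (f q)) :
    (l.map f).prod = (l.map fun p => if P p then 1 else f p).prod *
      (l.map fun p => if P p then f p else 1).prod := by
  induction l with
  | nil => simp
  | cons p l ih =>
    obtain ⟨h1, h2⟩ := List.pairwise_cons.1 hl
    simp only [List.map_cons, List.prod_cons]
    rw [ih h2]
    by_cases hp : P p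
    · rw [if_pos hp, if_pos hp, one_mul, ← mul_assoc, ← mul_assoc]
      congr 1
      refine Commute.list_prod_right _ _ fun y hy => ?_
      obtain ⟨q, hq, rfl⟩ := List.mem_map.1 hy
      split_ifs with hPq
      · exact Commute.one_right _
      · exact h1 q hq hp hPq
    · rw [if_neg hp, if_neg hp, one_mul, mul_assoc]

variable {m : ℕ}

/-- The coordinates of a product whose factors have complementary sets of nonzero coordinates, if
the product of the normal forms can be sorted by exchanging commuting factors. -/
theorem coord_mul_of_commute (P : UpperPair m → Prop) (g h : UT m)
    (hg : ∀ p, P p → coord s g p = 0) (hh : ∀ p, ¬ P p → coord s h p = 0)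
    (hc : ∀ p q, p < q → P p → ¬ P q → Commute (s p ^ coord s h p) (s q ^ coord s g q)) :
    coord s (g * h) = coord s g + coord s h := by
  classical
  have h1 := prod_map_eq_mul (fun p => s p ^ (coord s g p + coord s h p)) P
    (indices (UpperPair m)) (pairwise_indices.imp fun {p q} hpq hp hq => by
      rw [hg p hp, hh q hq, zero_add, add_zero]
      exact hc p q hpq hp hq)
  have h2 : (fun p => if P p then 1 else s p ^ (coord s g p + coord s h p)) =
      fun p => s p ^ coord s g p := by
    funext p
    split_ifs with hp
    · rw [hg p hp, zpow_zero]
    · rw [hh p hp, add_zero]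
  have h3 : (fun p => if P p then s p ^ (coord s g p + coord s h p) else 1) =
      fun p => s p ^ coord s h p := by
    funext p
    split_ifs with hp
    · rw [hg p hp, zero_add]
    · rw [hh p hp, zpow_zero]
  rw [h2, h3] at h1
  have h4 : normalForm s (coord s g + coord s h) =
      normalForm s (coord s g) * normalForm s (coord s h) := h1
  rw [normalForm_coord normalForm_bijective, normalForm_coord normalForm_bijective] at h4
  rw [← h4, coord_normalForm normalForm_bijective]

theorem commute_s_zpow {p q : UpperPair m} (h : p.col ≠ q.row) (h' : q.col ≠ p.row) (y z : ℤ) :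
    Commute (s p ^ y) (s q ^ z) := by
  apply toMat_injective
  rw [toMat_mul, toMat_mul, toMat_s_zpow, toMat_s_zpow]
  simp only [Matrix.transvection, add_mul, mul_add, one_mul, mul_one,
    Matrix.single_mul_single_of_ne _ _ _ _ h, Matrix.single_mul_single_of_ne _ _ _ _ h']
  abel

/-- The positions next to the diagonal. -/
def UpperPair.IsSimple (p : UpperPair m) : Prop := (p.col : ℕ) = p.row + 1

instance : DecidablePred (UpperPair.IsSimple (m := m)) := fun p =>
  inferInstanceAs (Decidable ((p.col : ℕ) = p.row + 1))

theorem UpperPair.IsSimple.lt {p q : UpperPair m} (hp : p.IsSimple) (hq : ¬ q.IsSimple) :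
    p < q := by
  refine UpperPair.lt_of_length_lt ?_
  have h : (q.row : ℕ) < q.col := q.lt
  rw [UpperPair.IsSimple] at hp hq
  omega

theorem entry_mul_of_isSimple {p : UpperPair m} (hp : p.IsSimple) (g h : UT m) :
    toMat (g * h) p.row p.col = toMat g p.row p.col + toMat h p.row p.col := by
  rw [toMat_mul, Matrix.mul_apply, ← Finset.sum_subset (Finset.subset_univ {p.row, p.col}),
    Finset.sum_pair p.lt.ne, (isUnitriangular_toMat g).diag, (isUnitriangular_toMat h).diag]
  · ring
  intro j _ hj
  simp only [Finset.mem_insert, Finset.mem_singleton, not_or] at hj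
  rcases lt_or_gt_of_ne hj.1 with hjr | hjr
  · rw [(isUnitriangular_toMat g).lower _ _ hjr, zero_mul]
  · have hjc : p.col < j := by
      refine lt_of_le_of_ne ?_ (Ne.symm hj.2)
      rw [UpperPair.IsSimple] at hp
      rw [Fin.le_def]
      have : (p.row : ℕ) < j := hjr
      omega
    rw [(isUnitriangular_toMat h).lower _ _ hjc, mul_zero]

theorem entry_inv_of_isSimple {p : UpperPair m} (hp : p.IsSimple) (g : UT m) :
    toMat g⁻¹ p.row p.col = - toMat g p.row p.col := by
  have h := entry_mul_of_isSimple hp g⁻¹ g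
  rw [inv_mul_cancel, toMat_one, Matrix.one_apply_ne p.lt.ne] at h
  linarith

theorem elim_of_isSimple {R : Type} [CommRing R] {p : UpperPair m} (hp : p.IsSimple)
    {l : List (UpperPair m)} (hpl : p ∈ l) {M : Matrix (Fin m) (Fin m) R}
    (hM : IsUnitriangular M) : elim l M p = M p.row p.col := by
  induction l generalizing M with
  | nil => simp at hpl
  | cons q l ih =>
    rw [elim]
    by_cases hpq : p = q
    · subst hpq
      rw [Function.update_self]
    · rw [Function.update_of_ne hpq, ih ((List.mem_cons.1 hpl).resolve_left hpq)
        (hM.transvection_mul q _), transvection_mul_apply, add_eq_left]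
      split_ifs with h
      · have h2 : p.col < q.col := by
          refine lt_of_le_of_ne ?_ fun h1 => hpq (UpperPair.ext h h1)
          rw [UpperPair.IsSimple] at hp
          have h3 : (q.row : ℕ) < q.col := q.lt
          rw [← h] at h3
          rw [Fin.le_def]
          omega
        rw [hM.lower _ _ h2, mul_zero]
      · rfl

theorem coord_of_isSimple {p : UpperPair m} (hp : p.IsSimple) (g : UT m) :
    coord s g p = toMat g p.row p.col := by
  rw [coord_eq_elim, elim_of_isSimple hp (mem_indices p) (isUnitriangular_toMat g)]

/-! ### The superdiagonal part -/

/-- The product of the factors with indices next to the diagonal in the normal form. -/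
def superdiagonalPart (g : UT m) : UT m :=
  normalForm s fun p => if p.IsSimple then toMat g p.row p.col else 0

/-- Simple positions precede all others, so the superdiagonal factors already stand in front and no
exchange is needed. -/
theorem coord_eq_coord_inv_superdiagonalPart_mul (g : UT m) {p : UpperPair m}
    (hp : ¬ p.IsSimple) : coord s g p = coord s ((superdiagonalPart g)⁻¹ * g) p := by
  have h1 (p : UpperPair m) : coord s (superdiagonalPart g) p =
      if p.IsSimple then toMat g p.row p.col else 0 :=
    congrFun (coord_normalForm normalForm_bijective _) p
  have h2 : coord s (superdiagonalPart g * ((superdiagonalPart g)⁻¹ * g)) =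
      coord s (superdiagonalPart g) + coord s ((superdiagonalPart g)⁻¹ * g) := by
    refine coord_mul_of_commute (fun p => ¬ p.IsSimple) _ _ (fun p hp => ?_) (fun p hp => ?_)
      fun p q hpq hp hq => absurd (hpq.trans ((not_not.1 hq).lt hp)) (lt_irrefl p)
    · rw [h1, if_neg hp]
    · rw [not_not] at hp
      rw [coord_of_isSimple hp, entry_mul_of_isSimple hp, entry_inv_of_isSimple hp,
        ← coord_of_isSimple hp (superdiagonalPart g), h1, if_pos hp,
        neg_add_cancel]
  rw [mul_inv_cancel_left] at h2
  conv_lhs => rw [h2, Pi.add_apply, h1, if_neg hp, zero_add]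

/-- Simple factors occur in ascending row order. Prepending one changes only its own row, which lies
above the rows `p.row` and `p.col` of any `p` later in the list, so the recursion from row `p.col`
to row `p.row` persists. -/
theorem matProd_row_of_isSimple {l : List (UpperPair m)} (hl : IsUpperList l)
    {x : UpperPair m → ℤ} (hx : ∀ p, ¬ p.IsSimple → x p = 0) {p : UpperPair m} (hp : p.IsSimple)
    (j : Fin m) : matProd l x p.row j = (1 : Matrix (Fin m) (Fin m) ℤ) p.row j +
      if p ∈ l then x p * matProd l x p.col j else 0 := by
  induction l generalizing p with
  | nil => simp [matProd]
  | cons q l ih =>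
    by_cases hq : q.IsSimple
    · rw [matProd_cons, transvection_mul_apply, transvection_mul_apply, ih hl.tail hp]
      by_cases hpq : p = q
      · subst hpq
        rw [if_neg hl.not_mem, if_pos rfl, if_pos List.mem_cons_self, if_neg p.lt.ne', add_zero,
          add_zero]
      · have hrow : p.row ≠ q.row := by
          intro h
          refine hpq (UpperPair.ext h (Fin.ext ?_))
          rw [UpperPair.IsSimple] at hp hq
          rw [hp, hq, h]
        rw [if_neg hrow, add_zero]
        by_cases hpl : p ∈ l
        · rw [if_pos hpl, if_pos (List.mem_cons_of_mem _ hpl), if_neg, add_zero]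
          intro h
          have h1 := (List.pairwise_cons.1 hl.pairwise).1 p hpl
          rw [UpperPair.lt_iff] at h1
          have h2 : (p.col : ℕ) = q.row := congrArg Fin.val h
          rw [UpperPair.IsSimple] at hp hq
          omega
        · rw [if_neg hpl, if_neg]
          simp [hpq, hpl]
    · have h1 : matProd (q :: l) x = matProd l x := by
        rw [matProd_cons, hx q hq, Matrix.transvection_zero, one_mul]
      have h2 : p ∈ q :: l ↔ p ∈ l := by
        rw [List.mem_cons, or_iff_right]
        rintro rfl
        exact hq hp
      rw [h1, ih hl.tail hp]
      simp only [h2]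

theorem normalForm_row_of_isSimple {x : UpperPair m → ℤ} (hx : ∀ p, ¬ p.IsSimple → x p = 0)
    {p : UpperPair m} (hp : p.IsSimple) (j : Fin m) :
    toMat (normalForm s x) p.row j = (1 : Matrix (Fin m) (Fin m) ℤ) p.row j +
      x p * toMat (normalForm s x) p.col j := by
  rw [toMat_normalForm, matProd_row_of_isSimple isUpperList_indices hx hp,
    if_pos (mem_indices p)]

theorem superdiagonalPart_row (g : UT m) {p : UpperPair m} (hp : p.IsSimple) (j : Fin m) :
    toMat (superdiagonalPart g) p.row j = (1 : Matrix (Fin m) (Fin m) ℤ) p.row j +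
      toMat g p.row p.col * toMat (superdiagonalPart g) p.col j := by
  rw [superdiagonalPart, normalForm_row_of_isSimple (fun p hp => if_neg hp) hp, if_pos hp]

/-! ### The last column -/

/-- The elements of `UT m` whose column `c` is a unit vector. -/
def fixCol (c : Fin m) : Subgroup (UT m) where
  carrier := {g | ∀ i, toMat g i c = (1 : Matrix (Fin m) (Fin m) ℤ) i c}
  one_mem' := fun _ => rfl
  mul_mem' := by
    intro g h hg hh i
    rw [toMat_mul, Matrix.mul_apply, Finset.sum_congr rfl fun j _ => by rw [hh j],
      ← Matrix.mul_apply, mul_one, hg i]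
  inv_mem' := by
    intro g hg i
    rw [← mul_one (toMat g⁻¹), Matrix.mul_apply, Finset.sum_congr rfl fun j _ => by rw [← hg j],
      ← Matrix.mul_apply, ← toMat_mul, inv_mul_cancel, toMat_one]

/-- The elements of `UT m` whose row `r` is a unit vector. -/
def fixRow (r : Fin m) : Subgroup (UT m) where
  carrier := {g | ∀ j, toMat g r j = (1 : Matrix (Fin m) (Fin m) ℤ) r j}
  one_mem' := fun _ => rfl
  mul_mem' := by
    intro g h hg hh j
    rw [toMat_mul, Matrix.mul_apply, Finset.sum_congr rfl fun i _ => by rw [hg i],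
      ← Matrix.mul_apply, one_mul, hh j]
  inv_mem' := by
    intro g hg j
    rw [← one_mul (toMat g⁻¹), Matrix.mul_apply, Finset.sum_congr rfl fun i _ => by rw [← hg i],
      ← Matrix.mul_apply, ← toMat_mul, mul_inv_cancel, toMat_one]

theorem fixRow_mul_apply {r : Fin m} {g : UT m} (hg : g ∈ fixRow r) (h : UT m) (j : Fin m) :
    toMat (g * h) r j = toMat h r j := by
  rw [toMat_mul, Matrix.mul_apply, Finset.sum_congr rfl fun i _ => by rw [hg i],
    ← Matrix.mul_apply, one_mul]

theorem elim_eq_zero_of_col {R : Type} [CommRing R] {c : Fin m} (l : List (UpperPair m))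
    {M : Matrix (Fin m) (Fin m) R} (hM : ∀ i, i ≠ c → M i c = 0) {p : UpperPair m}
    (hp : p.col = c) : elim l M p = 0 := by
  induction l generalizing M with
  | nil => rfl
  | cons q l ih =>
    rw [elim]
    by_cases hpq : p = q
    · subst hpq
      rw [Function.update_self, hp, hM _ (hp ▸ p.lt.ne)]
    · rw [Function.update_of_ne hpq]
      refine ih fun i hi => ?_
      rw [transvection_mul_apply, hM i hi, zero_add]
      split_ifs with h
      · by_cases hq : q.col = c
        · rw [hq, hM _ (hq ▸ q.lt.ne), neg_zero, zero_mul]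
        · rw [hM _ hq, mul_zero]
      · rfl

theorem coord_eq_zero_of_mem_fixCol {c : Fin m} {g : UT m} (hg : g ∈ fixCol c)
    {p : UpperPair m} (hp : p.col = c) : coord s g p = 0 := by
  rw [coord_eq_elim]
  refine elim_eq_zero_of_col _ (fun i hi => ?_) hp
  rw [hg i, Matrix.one_apply_ne hi]

variable {e : Fin m}

theorem matProd_mul_last {x : UpperPair m → ℤ}
    (hx : ∀ p, p.col ≠ e → x p = 0) (g : UT m) {p : UpperPair m} (hp : p.col = e)
    {l : List (UpperPair m)} (hl : l.Nodup) :
    (matProd l x * toMat g) p.row e = toMat g p.row e + if p ∈ l then x p else 0 := by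
  induction l with
  | nil => simp [matProd]
  | cons q l ih =>
    obtain ⟨h1, h2⟩ := List.nodup_cons.1 hl
    rw [matProd_cons, mul_assoc, transvection_mul_apply, ih h2]
    by_cases hq : q.col = e
    · have h3 : (matProd l x * toMat g) q.col e = 1 := by
        rw [← toMat_prod_zpow, ← toMat_mul, hq, (isUnitriangular_toMat _).diag]
      rw [h3, mul_one]
      by_cases hpq : p = q
      · subst hpq
        rw [if_neg h1, if_pos rfl, if_pos List.mem_cons_self, add_zero]
      · have hrow : p.row ≠ q.row := fun h => hpq (UpperPair.ext h (hp.trans hq.symm))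
        rw [if_neg hrow, add_zero]
        simp [hpq]
    · have hpq : p ≠ q := by rintro rfl; exact hq hp
      rw [hx q hq, zero_mul, ite_self, add_zero]
      simp [hpq]

/-- If the nonzero entries in the last column of `g⁻¹` are in the upper half, then the
coordinates that belong to the last column are, up to sign, the entries of that column. -/
theorem coord_last (he : (e : ℕ) + 1 = m) {g : UT m}
    (hg : ∀ j : Fin m, m ≤ 2 * (j : ℕ) + 1 → j ≠ e → toMat g⁻¹ j e = 0) {p : UpperPair m}
    (hp : p.col = e) : coord s g p = - toMat g⁻¹ p.row e := by
  -- These exponents cancel the last column of `g⁻¹`, so that `g` is an element fixing that column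
  -- times factors `s_{j,e}`.
  let x : UpperPair m → ℤ := fun p => if p.col = e then - toMat g⁻¹ p.row e else 0
  have hx : coord s (normalForm s x) = x := coord_normalForm normalForm_bijective x
  have h1 : (g * (normalForm s x)⁻¹) ∈ fixCol e := by
    rw [← inv_mem_iff, mul_inv_rev, inv_inv]
    intro i
    rcases lt_or_ge i e with hi | hi
    · have h2 := matProd_mul_last (x := x) (fun p hp => if_neg hp) g⁻¹
        (p := ⟨i, e, hi⟩) rfl (l := indices (UpperPair m)) (pairwise_indices.imp fun h => h.ne)
      rw [if_pos (mem_indices _), ← toMat_normalForm] at h2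
      rw [toMat_mul, h2, Matrix.one_apply_ne hi.ne]
      simp [x]
    · have hie : i = e := le_antisymm (by rw [Fin.le_def]; omega) hi
      rw [hie, (isUnitriangular_toMat _).diag, Matrix.one_apply_eq]
  have h3 := coord_mul_of_commute (fun p => p.col = e) (g * (normalForm s x)⁻¹)
    (normalForm s x) (fun p hp => coord_eq_zero_of_mem_fixCol h1 hp)
    (fun p hp => by rw [hx]; exact if_neg hp) fun p q hpq hp hq => ?_
  · rw [inv_mul_cancel_right] at h3
    rw [h3, Pi.add_apply, coord_eq_zero_of_mem_fixCol h1 hp, hx, zero_add]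
    exact if_pos hp
  -- A factor at `(j, e)` fails to commute with a factor at `(r, c)`, `c ≠ e`, only if `c = j`. If
  -- `(r, j)` comes later, then `e - j < j - r ≤ j`, which forces `j` into the lower half, where the
  -- exponent is zero.
  · by_cases hpm : m ≤ 2 * (p.row : ℕ) + 1
    · have h4 : x p = 0 := by
        rw [show x p = - toMat g⁻¹ p.row e from if_pos hp, hg _ hpm (hp ▸ p.lt.ne), neg_zero]
      rw [hx, h4, zpow_zero]
      exact Commute.one_left _
    · have h5 : (q.row : ℕ) < q.col := q.lt
      refine commute_s_zpow (fun h => ?_) (fun h => ?_) _ _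
      · rw [← h, hp] at h5
        omega
      · have h6 := UpperPair.lt_iff.1 hpq
        rw [hp, h] at h6
        omega

end Products

/-! ### Independent translates -/

section Translates

variable {m : ℕ} {e : Fin m}

@[elab_as_elim]
theorem downward_induction (he : (e : ℕ) + 1 = m) {P : Fin m → Prop} (h0 : P e)
    (h1 : ∀ p : UpperPair m, p.IsSimple → P p.col → P p.row) (j : Fin m) : P j := by
  induction hn : (e : ℕ) - j generalizing j with
  | zero =>
    have hj : j = e := Fin.ext (by omega)
    rwa [hj]
  | succ n ih =>
    have hlt : (j : ℕ) + 1 < m := by omega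
    exact h1 ⟨j, ⟨j + 1, hlt⟩, Fin.lt_def.2 (Nat.lt_succ_self _)⟩ rfl
      (ih _ (by dsimp only; omega))

theorem row_last (he : (e : ℕ) + 1 = m) (g : UT m) (c : Fin m) :
    toMat g e c = (1 : Matrix (Fin m) (Fin m) ℤ) e c := by
  rcases lt_or_ge c e with h | h
  · rw [(isUnitriangular_toMat g).lower _ _ h, Matrix.one_apply_ne h.ne']
  · have hc : c = e := le_antisymm (by rw [Fin.le_def]; omega) h
    rw [hc, (isUnitriangular_toMat g).diag, Matrix.one_apply_eq]

/-- By the row recursion, these rows depend only on superdiagonal entries in the same row or below.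
-/
theorem superdiagonalPart_congr (he : (e : ℕ) + 1 = m) {g h : UT m} {r : Fin m}
    (hgh : ∀ p : UpperPair m, p.IsSimple → r ≤ p.row →
      toMat g p.row p.col = toMat h p.row p.col) (j : Fin m) :
    r ≤ j → ∀ c, toMat (superdiagonalPart g) j c = toMat (superdiagonalPart h) j c := by
  refine downward_induction he (fun _ c => ?_) (fun p hp ih hrp c => ?_) j
  · rw [row_last he, row_last he]
  · rw [superdiagonalPart_row g hp, superdiagonalPart_row h hp, hgh p hp hrp,
      ih (hrp.trans p.lt.le)]

theorem superdiagonalPart_last_eq_one (he : (e : ℕ) + 1 = m) {g : UT m} {r : ℕ}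
    (hg : ∀ p : UpperPair m, p.IsSimple → r ≤ p.row → toMat g p.row p.col = 1) (j : Fin m) :
    r ≤ j → toMat (superdiagonalPart g) j e = 1 := by
  refine downward_induction he (fun _ => ?_) (fun p hp ih hrp => ?_) j
  · exact (isUnitriangular_toMat _).diag e
  · have h1 : p.row ≠ e := fun h => absurd p.lt (not_lt.2 (by rw [Fin.le_def, h]; omega))
    rw [superdiagonalPart_row g hp, hg p hp hrp,
      ih (hrp.trans (Fin.le_def.1 p.lt.le)), Matrix.one_apply_ne h1]
    rfl

/-- The recursion makes this entry the product of the superdiagonal entries of `g` from row `j`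
downwards. -/
theorem superdiagonalPart_last_ne_zero_iff (he : (e : ℕ) + 1 = m) {g : UT m} (j : Fin m) :
    toMat (superdiagonalPart g) j e ≠ 0 ↔
      ∀ p : UpperPair m, p.IsSimple → j ≤ p.row → toMat g p.row p.col ≠ 0 := by
  have hlt (p : UpperPair m) : p.row < e :=
    p.lt.trans_le (by rw [Fin.le_def]; omega)
  refine downward_induction he ?_ (fun p hp ih => ?_) j
  · refine iff_of_true ?_ fun p _ hep => absurd (hlt p) (not_lt.2 hep)
    rw [(isUnitriangular_toMat _).diag e]
    exact one_ne_zero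
  · rw [superdiagonalPart_row g hp, Matrix.one_apply_ne (hlt p).ne, zero_add, mul_ne_zero_iff, ih]
    constructor
    · rintro ⟨h1, h2⟩ q hq hpq
      rcases hpq.eq_or_lt with h | h
      · have hqp : q = p := by
          refine UpperPair.ext h.symm (Fin.ext ?_)
          rw [UpperPair.IsSimple] at hp hq
          rw [hp, hq, h]
        rwa [hqp]
      · refine h2 q hq ?_
        rw [UpperPair.IsSimple] at hp
        rw [Fin.lt_def] at h
        rw [Fin.le_def]
        omega
    · intro h
      exact ⟨h p hp le_rfl, fun q hq hpq => h q hq (p.lt.le.trans hpq)⟩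

theorem coord_eq_of_superdiagonalPart (he : (e : ℕ) + 1 = m) {g : UT m}
    (hg : ∀ j : Fin m, m ≤ 2 * (j : ℕ) + 1 → toMat (superdiagonalPart g) j e = toMat g j e)
    {p : UpperPair m} (hp : ¬ p.IsSimple) (hpe : p.col = e) :
    coord s g p = - toMat (g⁻¹ * superdiagonalPart g) p.row e := by
  have h1 : ((superdiagonalPart g)⁻¹ * g)⁻¹ = g⁻¹ * superdiagonalPart g := by
    rw [mul_inv_rev, inv_inv]
  rw [coord_eq_coord_inv_superdiagonalPart_mul g hp, coord_last he (fun j hj hje => ?_) hpe, h1]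
  rw [h1]
  -- In the lower half `g⁻¹` sees only rows where `E(g)` and `g` have the same last column, so the
  -- product looks like `g⁻¹ * g`; this is the hypothesis of `coord_last`.
  have h2 : toMat (g⁻¹ * superdiagonalPart g) j e = toMat (g⁻¹ * g) j e := by
    rw [toMat_mul, toMat_mul, Matrix.mul_apply, Matrix.mul_apply]
    refine Finset.sum_congr rfl fun i _ => ?_
    rcases lt_or_ge i j with hij | hij
    · rw [(isUnitriangular_toMat g⁻¹).lower _ _ hij, zero_mul, zero_mul]
    · rw [hg i (by rw [Fin.le_def] at hij; omega)]
  rw [h2, inv_mul_cancel, toMat_one, Matrix.one_apply_ne hje]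

/-- A combination of values of two coordinates in the last column. -/
theorem coord_sub_sub_eq (he : (e : ℕ) + 1 = m) {h : UT m}
    (hE : ∀ j : Fin m, m ≤ 2 * (j : ℕ) + 1 → toMat (superdiagonalPart h) j e = toMat h j e)
    {p0 p1 q : UpperPair m} (hp0 : ¬ p0.IsSimple) (hp1 : ¬ p1.IsSimple) (hp0e : p0.col = e)
    (hp1e : p1.col = e) (hq : q.IsSimple) (hq0 : (q.row : ℕ) = 0) (hqp0 : p0.row = q.row)
    (hqp1 : p1.row = q.col) (hh : h ∈ fixRow q.row) :
    coord s (h * (s q)⁻¹) p0 - coord s h p0 - coord s h p1 =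
      toMat (superdiagonalPart h) q.col e := by
  have hce : q.col ≠ e := hp1e ▸ hqp1 ▸ p1.lt.ne
  have hre : q.row ≠ e := hp0e ▸ hqp0 ▸ p0.lt.ne
  have hle {i : Fin m} (hi : i ≠ q.row) : q.col ≤ i := by
    rw [UpperPair.IsSimple] at hq
    have h1 : (i : ℕ) ≠ q.row := fun h => hi (Fin.ext h)
    rw [Fin.le_def]
    omega
  have hcol (j : Fin m) : toMat (h * (s q)⁻¹) j e = toMat h j e := by
    rw [toMat_mul, toMat_s_inv, Matrix.mul_transvection_apply_of_ne _ _ _ _ hce.symm]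
  have hentry : toMat (h * (s q)⁻¹) q.row q.col = -1 := by
    rw [entry_mul_of_isSimple hq, entry_inv_of_isSimple hq, s_entry, if_pos rfl, hh q.col,
      Matrix.one_apply_ne q.lt.ne, zero_add]
  have hrows (j : Fin m) (hj : q.col ≤ j) (c : Fin m) :
      toMat (superdiagonalPart (h * (s q)⁻¹)) j c = toMat (superdiagonalPart h) j c := by
    refine superdiagonalPart_congr he (fun p hp hqp => ?_) j hj c
    have hpq : p ≠ q := by
      rintro rfl
      exact absurd p.lt (not_lt.2 hqp)
    rw [entry_mul_of_isSimple hp, entry_inv_of_isSimple hp, s_entry, if_neg hpq, neg_zero,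
      add_zero]
  have hE0 : toMat (superdiagonalPart h) q.row e = 0 := by
    rw [superdiagonalPart_row h hq, hh q.col, Matrix.one_apply_ne q.lt.ne, zero_mul,
      Matrix.one_apply_ne hre, add_zero]
  -- This is the source of the result: translating by `s q` puts `-1` in the first superdiagonal
  -- place, so the top entry of `E`, zero for `h`, becomes minus the entry below it. The remaining
  -- contribution is cancelled by the coordinate at `p1`.
  have hg0 : toMat (superdiagonalPart (h * (s q)⁻¹)) q.row e =
      - toMat (superdiagonalPart h) q.col e := by
    rw [superdiagonalPart_row _ hq, hentry, hrows _ le_rfl, Matrix.one_apply_ne hre]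
    ring
  have hEg (j : Fin m) (hj : m ≤ 2 * (j : ℕ) + 1) :
      toMat (superdiagonalPart (h * (s q)⁻¹)) j e = toMat (h * (s q)⁻¹) j e := by
    rw [hcol, hrows j (hle ?_), hE j hj]
    rintro rfl
    have h1 : (q.row : ℕ) < q.col := q.lt
    have h2 := q.col.isLt
    omega
  have hprod : toMat (h⁻¹ * superdiagonalPart (h * (s q)⁻¹)) q.col e =
      toMat (h⁻¹ * superdiagonalPart h) q.col e := by
    rw [toMat_mul, toMat_mul, Matrix.mul_apply, Matrix.mul_apply]
    refine Finset.sum_congr rfl fun i _ => ?_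
    by_cases hi : i = q.row
    · rw [hi, (isUnitriangular_toMat h⁻¹).lower _ _ q.lt, zero_mul, zero_mul]
    · rw [hrows i (hle hi)]
  rw [coord_eq_of_superdiagonalPart he hEg hp0 hp0e, coord_eq_of_superdiagonalPart he hE hp0 hp0e,
    coord_eq_of_superdiagonalPart he hE hp1 hp1e, hqp0, hqp1,
    fixRow_mul_apply (inv_mem hh), hE0, mul_inv_rev, inv_inv, mul_assoc, toMat_mul (s q), toMat_s,
    transvection_mul_apply, if_pos rfl, fixRow_mul_apply (inv_mem hh), hg0, hprod]
  ring

theorem s_mem_fixRow {p : UpperPair m} {r : Fin m} (h : p.row ≠ r) : s p ∈ fixRow r := by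
  intro j
  rw [toMat_s, Matrix.transvection, Matrix.add_apply, Matrix.single_apply,
    if_neg fun h1 => h h1.1, add_zero]

theorem superdiagonal_isSimple (i : Fin (m - 1)) : (superdiagonal i).IsSimple := rfl

theorem exists_eq_superdiagonal {p : UpperPair m} (hp : p.IsSimple) :
    ∃ i, p = superdiagonal i := by
  have h1 : (p.row : ℕ) < p.col := p.lt
  have h2 := p.col.isLt
  exact ⟨⟨p.row, by omega⟩, UpperPair.ext rfl (Fin.ext hp)⟩

theorem superdiagonal_injective : Function.Injective (superdiagonal (m := m)) := by
  intro i j h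
  have h1 := congrArg (fun p : UpperPair m => (p.row : ℕ)) h
  exact Fin.ext h1

theorem w_mem_fixRow {S : Finset (Fin (m - 1))} {r : Fin m} (h : ∀ i ∈ S, (i : ℕ) ≠ r) :
    w S ∈ fixRow r := by
  refine Subgroup.list_prod_mem _ fun g hg => ?_
  obtain ⟨i, hi, rfl⟩ := List.mem_map.1 hg
  exact s_mem_fixRow fun h1 => h i ((Finset.mem_sort _).1 hi) (congrArg Fin.val h1)

theorem w_entry (S : Finset (Fin (m - 1))) (i : Fin (m - 1)) :
    toMat (w S) (superdiagonal i).row (superdiagonal i).col = if i ∈ S then 1 else 0 := by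
  have h1 (l : List (Fin (m - 1))) (hl : l.Nodup) :
      toMat (l.map fun i => s (superdiagonal i)).prod (superdiagonal i).row (superdiagonal i).col =
        if i ∈ l then 1 else 0 := by
    induction l with
    | nil => exact Matrix.one_apply_ne (superdiagonal i).lt.ne
    | cons j l ih =>
      obtain ⟨h2, h3⟩ := List.nodup_cons.1 hl
      rw [List.map_cons, List.prod_cons, entry_mul_of_isSimple (superdiagonal_isSimple i), ih h3,
        s_entry]
      simp only [superdiagonal_injective.eq_iff]
      by_cases hij : i = j
      · subst hij
        simp [h2]
      · simp [hij]
  rw [w, h1 _ (Finset.sort_nodup _ _)]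
  simp only [Finset.mem_sort]

/-- The product of the `s_{i,i+1}` with `i ≥ k`, where `i` is counted from `0`. -/
def tailProduct (m k : ℕ) : UT m :=
  normalForm s fun p => if p.IsSimple ∧ k ≤ p.row then 1 else 0

theorem tailProduct_entry {k : ℕ} {p : UpperPair m} (hp : p.IsSimple) :
    toMat (tailProduct m k) p.row p.col = if k ≤ p.row then 1 else 0 := by
  rw [← coord_of_isSimple hp, tailProduct, coord_normalForm normalForm_bijective]
  simp only [hp, true_and]

theorem superdiagonalPart_tailProduct (k : ℕ) :
    superdiagonalPart (tailProduct m k) = tailProduct m k := by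
  rw [superdiagonalPart]
  conv_rhs => rw [tailProduct]
  congr 1
  funext p
  by_cases hp : p.IsSimple
  · rw [if_pos hp, tailProduct_entry hp]
    simp only [hp, true_and]
  · simp only [hp, if_false, false_and]

theorem tailProduct_mem_fixRow {k : ℕ} {p : UpperPair m} (hp : p.IsSimple) (hk : (p.row : ℕ) < k) :
    tailProduct m k ∈ fixRow p.row := by
  intro j
  rw [← superdiagonalPart_tailProduct, superdiagonalPart_row _ hp, tailProduct_entry hp,
    if_neg (not_le.2 hk), zero_mul, add_zero]

theorem tailProduct_last (he : (e : ℕ) + 1 = m) {k : ℕ} {j : Fin m} (hj : k ≤ j) :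
    toMat (tailProduct m k) j e = 1 := by
  rw [← superdiagonalPart_tailProduct]
  exact superdiagonalPart_last_eq_one he
    (fun p hp hkp => by rw [tailProduct_entry hp, if_pos hkp]) j hj

end Translates

/-! ### The exponential lower bound for the dimension of the coordinate module -/

section LowerBound

variable {m : ℕ}

/-- The sets whose elements `i`, counted from `0`, satisfy `1 ≤ i < m / 2`. -/
abbrev HalfSet (m : ℕ) : Type :=
  {S : Finset (Fin (m - 1)) // ∀ i ∈ S, 1 ≤ (i : ℕ) ∧ (i : ℕ) + 1 ≤ m / 2}

theorem card_halfSet (m : ℕ) : Fintype.card (HalfSet m) = 2 ^ (m / 2 - 1) := by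
  have h1 : (Finset.univ.filter fun i : Fin (m - 1) =>
      1 ≤ (i : ℕ) ∧ (i : ℕ) + 1 ≤ m / 2).card = m / 2 - 1 := by
    rw [← Nat.card_Ico 1 (m / 2), ← Finset.card_map Fin.valEmbedding]
    congr 1
    ext i
    simp only [Finset.mem_map, Finset.mem_filter, Finset.mem_univ, true_and,
      Fin.valEmbedding_apply, Finset.mem_Ico]
    constructor
    · rintro ⟨j, hj, rfl⟩
      omega
    · intro hi
      exact ⟨⟨i, by omega⟩, by dsimp only; omega, rfl⟩
  rw [Fintype.card_subtype, ← h1, ← Finset.card_powerset]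
  congr 1
  ext S
  simp [Finset.subset_iff]

theorem exists_separating (hm : 4 ≤ m) : ∃ f ∈ coordModule (s (m := m)), ∀ S T : HalfSet m,
    act (w S.1) f (w T.1) ≠ 0 ↔
      ∀ i : Fin (m - 1), 1 ≤ (i : ℕ) → (i : ℕ) + 1 ≤ m / 2 → (i ∈ T.1 ↔ i ∉ S.1) := by
  let e : Fin m := ⟨m - 1, by omega⟩
  have he : (e : ℕ) + 1 = m := Nat.sub_add_cancel (by omega)
  let q : UpperPair m := superdiagonal ⟨0, by omega⟩
  let p0 : UpperPair m := ⟨q.row, e, Fin.lt_def.2 (show 0 < m - 1 by omega)⟩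
  let p1 : UpperPair m := ⟨q.col, e, Fin.lt_def.2 (show 0 + 1 < m - 1 by omega)⟩
  have hp0 : ¬ p0.IsSimple := fun h => by
    have h1 : m - 1 = 0 + 1 := h
    omega
  -- Here `m ≥ 4` is needed: for `m = 3` the position `p1` is next to the diagonal.
  have hp1 : ¬ p1.IsSimple := fun h => by
    have h1 : m - 1 = 0 + 1 + 1 := h
    omega
  let t (p : UpperPair m) : UT m → ℚ := fun h => (coord s h p : ℚ)
  -- Translating by the inverse of the tail evaluates at arguments multiplied by the tail. It
  -- supplies superdiagonal ones in rows `≥ m / 2`, where `w S` and `w T` have none and the product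
  -- would otherwise vanish.
  refine ⟨act (tailProduct m (m / 2))⁻¹ (act (s q) (t p0) - t p0 - t p1),
    act_mem_coordModule _ (sub_mem (sub_mem (act_mem_coordModule _ (coord_mem_coordModule _))
      (coord_mem_coordModule _)) (coord_mem_coordModule _)), fun S T => ?_⟩
  let h : UT m := w T.1 * (w S.1)⁻¹ * tailProduct m (m / 2)
  have hentry (i : Fin (m - 1)) : toMat h (superdiagonal i).row (superdiagonal i).col =
      (if i ∈ T.1 then 1 else 0) - (if i ∈ S.1 then 1 else 0) +
        if m / 2 ≤ (i : ℕ) then 1 else 0 := by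
    have hi := superdiagonal_isSimple i
    rw [entry_mul_of_isSimple hi, entry_mul_of_isSimple hi, entry_inv_of_isSimple hi, w_entry,
      w_entry, tailProduct_entry hi]
    rfl
  have hfix {r : Fin m} (hr : (r : ℕ) = 0 ∨ m / 2 ≤ r) : w T.1 * (w S.1)⁻¹ ∈ fixRow r := by
    refine mul_mem (w_mem_fixRow fun i hi => ?_) (inv_mem (w_mem_fixRow fun i hi => ?_))
    · have := T.2 i hi
      omega
    · have := S.2 i hi
      omega
  -- The lower rows of `h` are those of the tail, and both last columns consist of ones there.
  have hE (j : Fin m) (hj : m ≤ 2 * (j : ℕ) + 1) :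
      toMat (superdiagonalPart h) j e = toMat h j e := by
    have hj' : m / 2 ≤ j := by omega
    rw [fixRow_mul_apply (hfix (Or.inr hj')), tailProduct_last he hj']
    refine superdiagonalPart_last_eq_one he (fun p hp hkp => ?_) j hj'
    obtain ⟨i, rfl⟩ := exists_eq_superdiagonal hp
    have hi : m / 2 ≤ (i : ℕ) := hkp
    rw [hentry, if_pos hi, if_neg, if_neg]
    · rfl
    · intro h1
      have := S.2 i h1
      omega
    · intro h1
      have := T.2 i h1
      omega
  have hh : h ∈ fixRow q.row :=
    mul_mem (hfix (Or.inl rfl)) (tailProduct_mem_fixRow (superdiagonal_isSimple _)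
      (show 0 < m / 2 by omega))
  have h1 := coord_sub_sub_eq he hE hp0 hp1 rfl rfl (superdiagonal_isSimple _) rfl rfl rfl hh
  have h2 : act (w S.1) (act (tailProduct m (m / 2))⁻¹ (act (s q) (t p0) - t p0 - t p1)) (w T.1) =
      (toMat (superdiagonalPart h) q.col e : ℤ) := by
    rw [← h1]
    simp only [act, inv_inv, Pi.sub_apply, t]
    push_cast
    rfl
  rw [h2, Int.cast_ne_zero, superdiagonalPart_last_ne_zero_iff he]
  constructor
  · intro h3 i hi hi'
    have h4 := h3 (superdiagonal i) (superdiagonal_isSimple i) (Fin.le_def.2 hi)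
    rw [hentry, if_neg (show ¬ m / 2 ≤ (i : ℕ) by omega)] at h4
    by_cases hiS : i ∈ S.1 <;> by_cases hiT : i ∈ T.1 <;> simp_all
  · intro h3 p hp hqp
    obtain ⟨i, rfl⟩ := exists_eq_superdiagonal hp
    have hi : 1 ≤ (i : ℕ) := Fin.le_def.1 hqp
    rw [hentry]
    by_cases hk : m / 2 ≤ (i : ℕ)
    · rw [if_pos hk, if_neg, if_neg]
      · decide
      · intro h1
        have := S.2 i h1
        omega
      · intro h1
        have := T.2 i h1
        omega
    · have h4 := h3 i hi (by omega)
      rw [if_neg hk]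
      by_cases hiS : i ∈ S.1 <;> by_cases hiT : i ∈ T.1 <;> simp_all

theorem linearIndependent_of_eval {ι α : Type} (v : ι → α → ℚ) (x : ι → α)
    (h : ∀ i j, v i (x j) ≠ 0 ↔ i = j) : LinearIndependent ℚ v := by
  classical
  rw [linearIndependent_iff']
  intro u c hc j hj
  have h1 := congrFun hc (x j)
  rw [Finset.sum_apply, Finset.sum_eq_single j] at h1
  · exact (mul_eq_zero.1 h1).resolve_right ((h j j).2 rfl)
  · intro i _ hij
    have h2 : v i (x j) = 0 := not_not.1 fun h3 => hij ((h i j).1 h3)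
    rw [Pi.smul_apply, h2, smul_zero]
  · exact fun h2 => absurd hj h2

theorem exists_linearIndependent_translates (hm : 2 ≤ m) :
    ∃ f ∈ coordModule (s (m := m)), LinearIndependent ℚ fun S : HalfSet m => act (w S.1) f := by
  rcases lt_or_ge m 4 with hm4 | hm4
  -- For `m = 2, 3` the only subset is empty, so one nonzero function suffices; `t_{1,2}` takes the
  -- value `1` at `s q`.
  · have hsub : Subsingleton (HalfSet m) := by
      rw [← Fintype.card_le_one_iff_subsingleton, card_halfSet,
        show m / 2 - 1 = 0 by omega, pow_zero]
    let q : UpperPair m := superdiagonal ⟨0, by omega⟩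
    refine ⟨_, coord_mem_coordModule q, linearIndependent_of_eval _ (fun S => s q * w S.1)
      fun S T => ?_⟩
    rw [Subsingleton.elim T S]
    simp only [act, mul_inv_cancel_right, iff_true]
    rw [coord_of_isSimple (superdiagonal_isSimple _), s_entry, if_pos rfl]
    norm_num
  · obtain ⟨f, hf, h⟩ := exists_separating hm4
    -- Evaluating at `w` of the complement within the allowed range makes the matrix of values
    -- diagonal with nonzero diagonal entries.
    let C (S : HalfSet m) : HalfSet m :=
      ⟨Finset.univ.filter fun i => (1 ≤ (i : ℕ) ∧ (i : ℕ) + 1 ≤ m / 2) ∧ i ∉ S.1,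
        fun i hi => (Finset.mem_filter.1 hi).2.1⟩
    refine ⟨f, hf, linearIndependent_of_eval _ (fun S => w (C S).1) fun S T => ?_⟩
    rw [h]
    constructor
    · intro h1
      refine Subtype.ext (Finset.ext fun i => ?_)
      by_cases hi : 1 ≤ (i : ℕ) ∧ (i : ℕ) + 1 ≤ m / 2
      · have h2 := h1 i hi.1 hi.2
        simp only [C, Finset.mem_filter, Finset.mem_univ, true_and, hi] at h2
        tauto
      · exact iff_of_false (fun h3 => hi (S.2 i h3)) fun h3 => hi (T.2 i h3)
    · rintro rfl i hi hi'
      simp only [C, Finset.mem_filter, Finset.mem_univ, true_and, hi, hi']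

/-- The multiplication polynomials make every translate of a coordinate polynomial, hence all of the
module. -/
theorem exists_polyFun_eq {f : UT m → ℚ} (hf : f ∈ coordModule (s (m := m))) :
    ∃ p, polyFun s p = f := by
  obtain ⟨q, hq, -⟩ := existsUnique_multiplicationPolynomials (m := m)
  have h1 : coordModule (s (m := m)) ≤ LinearMap.range (polyFunHom s).toLinearMap := by
    refine coordModule_le fun g i => ?_
    obtain ⟨p, hp⟩ := exists_polyFun_eq_act normalForm_bijective hq g (MvPolynomial.X i)
    refine ⟨p, (polyFunHom_apply p).trans ?_⟩
    rw [hp, polyFun_X]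
  obtain ⟨p, hp⟩ := h1 hf
  exact ⟨p, (polyFunHom_apply p).symm.trans hp⟩

theorem pow_le_finrank_coordModule (hm : 2 ≤ m) :
    2 ^ (m / 2 - 1) ≤ Module.finrank ℚ (coordModule (s (m := m))) := by
  obtain ⟨f, hf, h⟩ := exists_linearIndependent_translates hm
  have h1 : LinearIndependent ℚ fun S : HalfSet m =>
      (⟨act (w S.1) f, act_mem_coordModule _ hf⟩ : coordModule (s (m := m))) :=
    LinearIndependent.of_comp (coordModule (s (m := m))).subtype h
  rw [← card_halfSet]
  exact h1.fintype_card_le_finrank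

theorem pow_le_of_basis (hm : 2 ≤ m) {N : ℕ} {b : Fin N → UT m → ℚ}
    (hb : LinearIndependent ℚ b) (hspan : Submodule.span ℚ (Set.range b) = coordModule s) :
    2 ^ (m / 2 - 1) ≤ N := by
  have h1 := finrank_span_eq_card hb
  rw [hspan, Fintype.card_fin] at h1
  exact (pow_le_finrank_coordModule hm).trans_eq h1

theorem rpow_le_of_pow_le {N : ℕ} (h : 2 ^ (m / 2 - 1) ≤ N) :
    (2 : ℝ) ^ ((m : ℝ) / 2 - 2) ≤ N := by
  have h1 : (2 : ℝ) ^ ((m : ℝ) / 2 - 2) ≤ (2 : ℝ) ^ ((m / 2 - 1 : ℕ) : ℝ) := by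
    refine Real.rpow_le_rpow_of_exponent_le one_le_two ?_
    -- The slack in the exponent covers the rounding in `m / 2`.
    have h2 : m ≤ 2 * (m / 2 - 1) + 4 := by omega
    have h3 : (m : ℝ) ≤ 2 * ((m / 2 - 1 : ℕ) : ℝ) + 4 := by exact_mod_cast h2
    linarith
  rw [Real.rpow_natCast] at h1
  exact h1.trans (by exact_mod_cast h)

end LowerBound

end Nickel

theorem theorem3p6 (m : ℕ) (hm : 2 ≤ m) :
    -- the standard family is a Mal'cev basis, and it has unique multiplication polynomials
    Nickel.IsMalcevBasis (Nickel.s (m := m)) ∧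
    (∃! q, Nickel.IsMultiplicationPolynomials (Nickel.s (m := m)) q) ∧
    -- every matrix embedding into `UT_N(ℤ)` obtained from the module of coordinate functions
    (∀ (N : ℕ) (φ : Nickel.UT m →* Nickel.UT N),
      Nickel.IsNickelEmbedding (Nickel.s (m := m)) N φ →
        2 ^ (m / 2 - 1) ≤ N ∧ (2 : ℝ) ^ ((m : ℝ) / 2 - 2) ≤ N) ∧
    -- Nickel's algorithm terminates; its output is a basis of that module; the length `N` of the
    -- output and the number `c` of calls of `Insert` are exponential in `m`
    (∀ q, Nickel.IsMultiplicationPolynomials (Nickel.s (m := m)) q →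
      ∀ ord : LinearOrder (Nickel.UpperPair m →₀ ℕ),
        (∃ B c, Nickel.Run ord q B c) ∧
        ∀ B c, Nickel.Run ord q B c →
          LinearIndependent ℚ (fun k : Fin B.length => Nickel.polyFun Nickel.s (B.get k)) ∧
          Submodule.span ℚ (Set.range fun k : Fin B.length => Nickel.polyFun Nickel.s (B.get k)) =
            Nickel.coordModule (Nickel.s (m := m)) ∧
          2 ^ (m / 2 - 1) ≤ B.length ∧ (2 : ℝ) ^ ((m : ℝ) / 2 - 2) ≤ B.length ∧
          2 ^ (m / 2 - 1) ≤ c ∧ (2 : ℝ) ^ ((m : ℝ) / 2 - 2) ≤ c) ∧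
    -- independent translates of one polynomial, for `S ⊆ {2, …, ⌊m/2⌋}` (here counted from `0`)
    ∃ p : MvPolynomial (Nickel.UpperPair m) ℚ,
      Nickel.polyFun Nickel.s p ∈ Nickel.coordModule (Nickel.s (m := m)) ∧
      LinearIndependent ℚ
        (fun S : {S : Finset (Fin (m - 1)) // ∀ i ∈ S, 1 ≤ (i : ℕ) ∧ (i : ℕ) + 1 ≤ m / 2} =>
          Nickel.act (Nickel.w S.1) (Nickel.polyFun Nickel.s p)) := by
  have hb := Nickel.normalForm_bijective (m := m)
  refine ⟨Nickel.isMalcevBasis_s, Nickel.existsUnique_multiplicationPolynomials,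
    fun N φ hφ => ?_, fun q hq ord => ⟨Nickel.exists_run hb hq ord, fun B c h => ?_⟩, ?_⟩
  · obtain ⟨-, b, hb, hspan, -⟩ := hφ
    have h1 := Nickel.pow_le_of_basis hm hb hspan
    exact ⟨h1, Nickel.rpow_le_of_pow_le h1⟩
  · have h1 := h.linearIndependent hb
    have h2 := h.span_eq hb hq
    have h3 := Nickel.pow_le_of_basis hm h1 h2
    have h4 := h3.trans h.length_le
    exact ⟨h1, h2, h3, Nickel.rpow_le_of_pow_le h3, h4, Nickel.rpow_le_of_pow_le h4⟩
  · obtain ⟨f, hf, h⟩ := Nickel.exists_linearIndependent_translates hm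
    obtain ⟨p, rfl⟩ := Nickel.exists_polyFun_eq hf
    exact ⟨p, hf, h⟩
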